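/- **Conventions.** For $0<\Theta<\pi$, a $\Theta$-cone is an open planar cone with apex angle $\Theta$; it is empty with respect to a finite guard set $G\subset\mathbb{R}^2$ if it contains no point of $G$. The $\Theta$-region of $G$ is the set of all $p\in\mathbb{R}^2$ such that no $\Theta$-cone with apex $p$ is empty. The complexity of a region is the least number of circular arcs or line segments of which its boundary is the union. Let $B_s=[-s,s]^2$. **Construction.** For an integer $i\ge 1$ let $\Theta_i=2\arctan\frac1{8i}$, the angle at $(\frac12,0)$ between the rays through $(0,4i)$ and $(1,4i)$. *First step.* For each integer $m$ with $-i\le m<i$ place the guards $(m,4i)$, $(m+1,4i)$, $(m,2i)$, $(m+\frac14,2i)$, $(m+\frac34,2i)$, $(m+1,2i)$. For each integer $m$ with $-4i\le m<-i$ or $i\le m<4i$ place the guards $(m,4i)$, $(m+\frac12,4i)$, $(m+1,4i)$. Add the images of all these guards under the rotations about the origin by $90^\circ$, $180^\circ$ and $270^\circ$. For integers $-i\le k,l<i$, a $\Theta_i$-cone *passes through $P_k$ and $Q_l$* if its apex has $y$-coordinate less than $2i$ and it meets the line $y=4i$ in a non-empty subset of $[k,k+1]\times\{4i\}$ and the line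 $y=2i$ in a non-empty subset of $[l+\frac14,l+\frac34]\times\{2i\}$. Such a cone is *deepest* if it is empty with respect to the guards of the first step and its apex has the smallest $y$-coordinate among all such empty cones. A $\Theta_i$-cone is *wanted* if some rotation of it about the origin by a multiple of $90^\circ$ passes through $P_k$ and $Q_k$ for some $k$. *Second step.* Given $x>0$, for every direction of the medial axis of a deepest cone through some $P_k$ and $Q_l$ with $k\ne l$, place a guard at the point where the ray from the origin in this direction meets the boundary of $B_x$. Again add the images of these guards under the rotations by $90^\circ$, $180^\circ$ and $270^\circ$. Let $G_i=G_i(x)$ be the set of all guards of both steps. **Theorem.** $\Theta_i\to0$ as $i\to\infty$, and there are a constant $c>0$ and thresholds $X_i\in\mathbb{R}$ such that for every $i\ge1$ and every $x\ge X_i$: 1. $G_i$ is finite and has exactly $n_i=96i-4$ points; 2. every empty $\Theta_i$-cone (with respect to $G_i$) that intersects $B_i$ is wanted; 3. the intersection of the $\Theta_i$-region of $G_i$ with $B_i$ has exactly $(2i+1)^2$ connected components; 4. the complexity of the $\Theta_i$-region of $G_i$ is at least $c\,n_i^2$. In particular there is a sequence of inputs $(\Theta_i,n_i,G_i)$ with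 $\Theta_i\to0$ whose $\Theta_i$-regions have complexity $\Omega(n_i^2)$. -/

import Mathlib

open Filter Topology
open scoped ENNReal

noncomputable section

namespace ThetaGuard

/-- The Euclidean plane, with Cartesian coordinates `(q.1, q.2)`. -/
abbrev Plane : Type := ℝ × ℝ

/-! ### Guarding -/

/-- The open cone with apex `p`, apex angle `Θ` and medial axis in direction
`(cos φ, sin φ)`; for `0 < Θ ≤ 2π` these are all the `Θ`-cones. -/
def cone (Θ : ℝ) (p : Plane) (φ : ℝ) : Set Plane :=
  {q | ∃ r : ℝ, 0 < r ∧ ∃ ψ : ℝ, |ψ - φ| < Θ / 2 ∧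
    q = (p.1 + r * Real.cos ψ, p.2 + r * Real.sin ψ)}

/-- A set of points is empty with respect to `G` if it contains no guard. -/
def IsEmptyOf (C G : Set Plane) : Prop := C ∩ G = ∅

/-- The `Θ`-region of `G`: the points `p` such that no `Θ`-cone with apex `p` is empty. -/
def thetaRegion (Θ : ℝ) (G : Set Plane) : Set Plane :=
  {p | ∀ φ : ℝ, ¬ IsEmptyOf (cone Θ p φ) G}

/-! ### Complexity of a region -/

/-- The closed circular arc with centre `c` and radius `r` over the angles in `[a, b]`. -/
def circularArc (c : Plane) (r a b : ℝ) : Set Plane :=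
  (fun t : ℝ => ((c.1 + r * Real.cos t, c.2 + r * Real.sin t) : Plane)) '' Set.Icc a b

/-- A possible boundary edge: a circular arc or a straight line segment. -/
def IsBoundaryEdge (S : Set Plane) : Prop :=
  (∃ (c : Plane) (r a b : ℝ), 0 < r ∧ a ≤ b ∧ S = circularArc c r a b) ∨
    ∃ p q : Plane, S = segment ℝ p q

/-- The complexity of a region: the least number of circular arcs (or line segments) that
make up its boundary. -/
def complexity (S : Set Plane) : ℕ∞ :=
  ⨅ (A : Finset (Set Plane)) (_ : (∀ a ∈ A, IsBoundaryEdge a) ∧ ⋃ a ∈ A, a = frontier S),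
    (A.card : ℕ∞)

/-! ### The construction -/

/-- The closed axis-parallel square with edge length `2 s` centred at the origin. -/
def box (s : ℝ) : Set Plane := {q | |q.1| ≤ s ∧ |q.2| ≤ s}

/-- Rotation by a right angle about the origin. -/
def rot (q : Plane) : Plane := (-q.2, q.1)

/-- The union of the four copies of `S` (upper, left, lower, right) under the rotations by
multiples of a right angle. -/
def fourfold (S : Set Plane) : Set Plane := ⋃ s ∈ Finset.range 4, rot^[s] '' S

/-- The angle at `(1/2, 0)` between the rays through `(0, 4i)` and `(1, 4i)`:
half of it has the tangent `(1/2) / (4i)`. -/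
def theta (i : ℕ) : ℝ := 2 * Real.arctan (1 / (8 * (i : ℝ)))

/-- Guard pattern A in the cell `[m, m+1] × [0, 4i]`: four guards on the boundary of the
`theta i`-cone with apex `(m + 1/2, 0)` at the heights `4i` and `2i`, and two guards separating
this cell from its neighbours. -/
def patternA (i : ℕ) (m : ℤ) : Set Plane :=
  {((m : ℝ), 4 * (i : ℝ)), ((m : ℝ) + 1, 4 * (i : ℝ)),
    ((m : ℝ) + 1 / 4, 2 * (i : ℝ)), ((m : ℝ) + 3 / 4, 2 * (i : ℝ)),
    ((m : ℝ), 2 * (i : ℝ)), ((m : ℝ) + 1, 2 * (i : ℝ))}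

/-- Guard pattern B in the cell `[m, m+1] × [0, 4i]`: three equidistant guards on the top edge. -/
def patternB (i : ℕ) (m : ℤ) : Set Plane :=
  {((m : ℝ), 4 * (i : ℝ)), ((m : ℝ) + 1 / 2, 4 * (i : ℝ)), ((m : ℝ) + 1, 4 * (i : ℝ))}

/-- First step, upper half of `box (4i)`: of the `8i` cells of width 1, the medial quarter is
stamped with pattern A and the others with pattern B. -/
def firstUpper (i : ℕ) : Set Plane :=
  {q | ∃ m : ℤ, -(i : ℤ) ≤ m ∧ m < i ∧ q ∈ patternA i m} ∪
  {q | ∃ m : ℤ, -(4 * (i : ℤ)) ≤ m ∧ m < 4 * i ∧ ¬ (-(i : ℤ) ≤ m ∧ m < i) ∧ q ∈ patternB i m}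

/-- All guards of the first step. -/
def firstStep (i : ℕ) : Set Plane := fourfold (firstUpper i)

/-- The set `C` meets the horizontal line at height `y`, and does so only in the
segment from `(a, y)` to `(b, y)`. -/
def PassesBetween (C : Set Plane) (a b y : ℝ) : Prop :=
  (∃ q ∈ C, q.2 = y) ∧ ∀ q ∈ C, q.2 = y → a ≤ q.1 ∧ q.1 ≤ b

/-- The `theta i`-cone with apex `p` and direction `φ` enters from above through the guard pair
`P_k = {(k, 4i), (k + 1, 4i)}` and the guard pair `Q_l = {(l + 1/4, 2i), (l + 3/4, 2i)}`,
its apex lying below these pairs. -/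
def PassesThrough (i : ℕ) (k l : ℤ) (p : Plane) (φ : ℝ) : Prop :=
  p.2 < 2 * (i : ℝ) ∧
  PassesBetween (cone (theta i) p φ) k ((k : ℝ) + 1) (4 * (i : ℝ)) ∧
  PassesBetween (cone (theta i) p φ) ((l : ℝ) + 1 / 4) ((l : ℝ) + 3 / 4) (2 * (i : ℝ))

/-- The deepest cone through `P_k` and `Q_l`: an empty cone, with respect to the guards of the
first step, whose apex has the least `y`-value. -/
def IsDeepest (i : ℕ) (k l : ℤ) (p : Plane) (φ : ℝ) : Prop :=
  (PassesThrough i k l p φ ∧ IsEmptyOf (cone (theta i) p φ) (firstStep i)) ∧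
  ∀ (p' : Plane) (φ' : ℝ), PassesThrough i k l p' φ' →
    IsEmptyOf (cone (theta i) p' φ') (firstStep i) → p.2 ≤ p'.2

/-- Second step, upper half: for each direction of the medial axis of a deepest cone through
`P_k` and `Q_l` with `k ≠ l`, the point where the ray from the origin in this direction meets
the boundary of `box x`. -/
def secondUpper (i : ℕ) (x : ℝ) : Set Plane :=
  {g | ∃ k l : ℤ, (-(i : ℤ) ≤ k ∧ k < i) ∧ (-(i : ℤ) ≤ l ∧ l < i) ∧ k ≠ l ∧
    ∃ (p : Plane) (φ : ℝ), IsDeepest i k l p φ ∧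
      ∃ r : ℝ, 0 < r ∧ g = (r * Real.cos φ, r * Real.sin φ) ∧ max |g.1| |g.2| = x}

/-- The whole guard set, with the additional guards on the boundary of `box x`. -/
def guards (i : ℕ) (x : ℝ) : Set Plane := firstStep i ∪ fourfold (secondUpper i x)

/-- A wanted cone: up to a rotation by a multiple of a right angle, it passes through `P_k` and
`Q_k` for one of the `2i` cells with pattern A. -/
def IsWantedCone (i : ℕ) (p : Plane) (φ : ℝ) : Prop :=
  ∃ s ∈ Finset.range 4, ∃ k : ℤ, (-(i : ℤ) ≤ k ∧ k < i) ∧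
    PassesThrough i k k (rot^[s] p) (φ + s * (Real.pi / 2))

end ThetaGuard

end

/-! Up to a quarter turn, the axis of an empty cone with apex in `box i` leaves `box (4i)` through
its top side. Such a cone widens by at least `2 * halfTan i` per unit of height, so at height `4i`
it is at least 3/4 wide and cannot use a gap of 1/2 of pattern B: it passes some `P_k`. At height
`2i`, a gap of 1/4 only admits a vertical cone with apex at height exactly `i`, and that cone does
not fit into any `P_k`. So the cone passes some `P_k` and some `Q_l` (`passesThrough_of_isEmptyOf`).

Let `k > l`; the case `k < l` is its mirror image. The deepest cone touches both guards of `P_k` and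
the right guard of `Q_l`, and the slope `V` of its axis depends only on `k - l`. For every cone
through this pair with apex in `box i`, `V` lies strictly between the slopes of the bounding rays,
by a margin that does not depend on `x`. Hence for large `x` the far guard in direction `V` lies
inside that cone, although the apex is not the origin (`Threads.far_bounds_of_pos`). Conversely,
wanted cones with apex in `box i` are too close to vertical to contain a far guard
(`PassesThrough.isEmptyOf_guards`). So the complement of the region in `box i` is exactly the union
of the rotated sets `spike` (`notMem_thetaRegion_iff`).

By the inscribed angle theorem a spike is governed by discs, so it is convex (`convex_spike`). It
stays over `[k + 1/4, k + 3/4]` and contains its axis above `k + 1/2`. Thus spikes cover the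
half-integer grid lines of the box and avoid the lattice points, and the region within each grid
cell is star-shaped about the lattice point (`thetaRegion_star`): there is one component per lattice
point. An arc or segment of the boundary is connected and cannot cross the grid lines, so each of
`(i - 1) ^ 2` cells in the positive quadrant needs an edge of its own, while the number of guards is
linear in `i`. -/

namespace ThetaGuard

/-! ### Cones as linear inequalities -/

/-- The tangent of half of the apex angle `theta i`. -/
noncomputable def halfTan (i : ℕ) : ℝ := 1 / (8 * (i : ℝ))

theorem halfTan_pos {i : ℕ} (hi : 1 ≤ i) : 0 < halfTan i := by
  have : (0 : ℝ) < i := by exact_mod_cast hi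
  unfold halfTan
  positivity

theorem halfTan_mul {i : ℕ} (hi : 1 ≤ i) : halfTan i * i = 1 / 8 := by
  have : (0 : ℝ) < i := by exact_mod_cast hi
  unfold halfTan
  field_simp

theorem halfTan_le {i : ℕ} (hi : 1 ≤ i) : halfTan i ≤ 1 / 8 := by
  have h1 : (1 : ℝ) ≤ i := by exact_mod_cast hi
  have := halfTan_mul hi
  have := halfTan_pos hi
  nlinarith

/-- In coordinates along and across the axis, the tangent of the deviation is below `halfTan i`. A
positive component along the axis is forced by the inequality itself. -/
theorem mem_cone_iff (i : ℕ) (p q : Plane) (φ : ℝ) :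
    q ∈ cone (theta i) p φ ↔
      |(q.2 - p.2) * Real.cos φ - (q.1 - p.1) * Real.sin φ| <
        halfTan i * ((q.1 - p.1) * Real.cos φ + (q.2 - p.2) * Real.sin φ) := by
  have hθ : theta i / 2 = Real.arctan (halfTan i) := by
    unfold theta halfTan; ring
  constructor
  · rintro ⟨r, hr, ψ, hψ, rfl⟩
    rw [hθ] at hψ
    have e1 : (p.2 + r * Real.sin ψ - p.2) * Real.cos φ - (p.1 + r * Real.cos ψ - p.1) * Real.sin φ
        = r * Real.sin (ψ - φ) := by rw [Real.sin_sub]; ring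
    have e2 : (p.1 + r * Real.cos ψ - p.1) * Real.cos φ + (p.2 + r * Real.sin ψ - p.2) * Real.sin φ
        = r * Real.cos (ψ - φ) := by rw [Real.cos_sub]; ring
    simp only [e1, e2]
    have hlt := Real.arctan_lt_pi_div_two (halfTan i)
    obtain ⟨h1, h2⟩ := abs_lt.mp hψ
    have hc : 0 < Real.cos (ψ - φ) := Real.cos_pos_of_mem_Ioo ⟨by linarith, by linarith⟩
    have ht : Real.arctan (Real.tan (ψ - φ)) = ψ - φ :=
      Real.arctan_tan (by linarith) (by linarith)
    have h3 : Real.tan (ψ - φ) < halfTan i := by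
      rw [← Real.arctan_strictMono.lt_iff_lt, ht]; exact h2
    have h4 : -halfTan i < Real.tan (ψ - φ) := by
      rw [← Real.arctan_strictMono.lt_iff_lt, ht, Real.arctan_neg]; exact h1
    rw [Real.tan_eq_sin_div_cos] at h3 h4
    rw [div_lt_iff₀ hc] at h3
    rw [lt_div_iff₀ hc] at h4
    rw [abs_lt]
    constructor <;> nlinarith
  · intro h
    set D := (q.1 - p.1) * Real.cos φ + (q.2 - p.2) * Real.sin φ with hD
    set K := (q.2 - p.2) * Real.cos φ - (q.1 - p.1) * Real.sin φ with hK
    have hsc := Real.sin_sq_add_cos_sq φ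
    have ht0 : 0 ≤ halfTan i := by unfold halfTan; positivity
    have hD0 : 0 < D := by
      by_contra hneg
      have := abs_nonneg K
      nlinarith
    obtain ⟨h1, h2⟩ := abs_lt.mp h
    have hc := Real.cos_arctan_pos (K / D)
    have hs : Real.sin (Real.arctan (K / D)) = K / D * Real.cos (Real.arctan (K / D)) := by
      have := Real.tan_arctan (K / D)
      rw [Real.tan_eq_sin_div_cos, div_eq_iff hc.ne'] at this
      exact this
    refine ⟨D / Real.cos (Real.arctan (K / D)), by positivity, φ + Real.arctan (K / D), ?_, ?_⟩
    · rw [hθ, add_sub_cancel_left, abs_lt, ← Real.arctan_neg]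
      constructor
      · apply Real.arctan_strictMono
        rw [lt_div_iff₀ hD0]; linarith
      · apply Real.arctan_strictMono
        rw [div_lt_iff₀ hD0]; linarith
    · rw [Real.cos_add, Real.sin_add, hs]
      have e1 : q.1 - p.1 = D * Real.cos φ - K * Real.sin φ := by
        rw [hD, hK]; linear_combination -(q.1 - p.1) * hsc
      have e2 : q.2 - p.2 = D * Real.sin φ + K * Real.cos φ := by
        rw [hD, hK]; linear_combination -(q.2 - p.2) * hsc
      ext
      · simp only
        field_simp
        linarith
      · simp only
        field_simp
        linarith

/-- The slope (horizontal run per unit height) of the left bounding ray of an upward cone with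
half angle `arctan (halfTan i)` whose axis has slope `v`. -/
noncomputable def lo (i : ℕ) (v : ℝ) : ℝ := (v - halfTan i) / (1 + halfTan i * v)

/-- The slope of the right bounding ray. -/
noncomputable def hi (i : ℕ) (v : ℝ) : ℝ := (v + halfTan i) / (1 - halfTan i * v)

/-- The cone with axis slope `v` opens upwards with both bounding rays. -/
def Upward (i : ℕ) (v : ℝ) : Prop := 0 < 1 + halfTan i * v ∧ 0 < 1 - halfTan i * v

theorem Upward.neg {i : ℕ} {v : ℝ} (h : Upward i v) : Upward i (-v) := by
  obtain ⟨h1, h2⟩ := h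
  constructor <;> linarith

theorem lo_neg (i : ℕ) (v : ℝ) : lo i (-v) = -hi i v := by
  unfold lo hi; rw [← neg_div]; congr 1 <;> ring

theorem hi_neg (i : ℕ) (v : ℝ) : hi i (-v) = -lo i v := by
  unfold lo hi; rw [← neg_div]; congr 1 <;> ring

/-- Dividing by `sin φ` turns the bound on the absolute value into one linear condition per bounding
ray. -/
theorem mem_cone_iff_slope {i : ℕ} {p q : Plane} {φ : ℝ} (hs : 0 < Real.sin φ)
    (hu : Upward i (Real.cos φ / Real.sin φ)) :
    q ∈ cone (theta i) p φ ↔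
      lo i (Real.cos φ / Real.sin φ) * (q.2 - p.2) < q.1 - p.1 ∧
      q.1 - p.1 < hi i (Real.cos φ / Real.sin φ) * (q.2 - p.2) := by
  obtain ⟨h1, h2⟩ := hu
  set v := Real.cos φ / Real.sin φ with hv
  have hc : Real.cos φ = v * Real.sin φ := by rw [hv]; field_simp
  clear_value v
  rw [mem_cone_iff, hc, abs_lt]
  unfold lo hi
  rw [div_mul_eq_mul_div, div_mul_eq_mul_div, div_lt_iff₀ h1, lt_div_iff₀ h2]
  constructor
  · rintro ⟨a, b⟩
    constructor
    · apply lt_of_mul_lt_mul_left _ hs.le; nlinarith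
    · apply lt_of_mul_lt_mul_left _ hs.le; nlinarith
  · rintro ⟨a, b⟩
    have a' := mul_lt_mul_of_pos_left a hs
    have b' := mul_lt_mul_of_pos_left b hs
    constructor <;> nlinarith

theorem hi_sub_lo_pos {i : ℕ} (h1 : 1 ≤ i) {v : ℝ} (hu : Upward i v) : lo i v < hi i v := by
  have ht := halfTan_pos h1
  unfold lo hi
  rw [div_lt_div_iff₀ hu.1 hu.2]
  nlinarith [mul_nonneg ht.le (sq_nonneg v), sq_nonneg v]

theorem lo_lt_self {i : ℕ} (h1 : 1 ≤ i) {v : ℝ} (hu : Upward i v) : lo i v < v := by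
  have ht := halfTan_pos h1
  unfold lo
  rw [div_lt_iff₀ hu.1]
  nlinarith [mul_nonneg ht.le (sq_nonneg v)]

theorem hi_sub_lo {i : ℕ} {v : ℝ} (hu : Upward i v) :
    hi i v - lo i v = 2 * halfTan i * (1 + v ^ 2) / ((1 + halfTan i * v) * (1 - halfTan i * v)) := by
  have a := hu.1.ne'
  have b := hu.2.ne'
  unfold lo hi
  rw [div_sub_div _ _ b a, mul_comm (1 + halfTan i * v)]
  congr 1
  ring

theorem le_hi_sub_lo {i : ℕ} (h1 : 1 ≤ i) {v : ℝ} (hu : Upward i v) :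
    2 * halfTan i * (1 + v ^ 2) ≤ hi i v - lo i v := by
  have ht := halfTan_pos h1
  rw [hi_sub_lo hu, le_div_iff₀ (mul_pos hu.1 hu.2)]
  have : (1 + halfTan i * v) * (1 - halfTan i * v) ≤ 1 := by nlinarith [sq_nonneg (halfTan i * v)]
  have h0 : 0 ≤ 2 * halfTan i * (1 + v ^ 2) := by positivity
  nlinarith

/-- The section of the open cone is an open interval, so by density the bounding rays are allowed to
touch the ends of the gap. -/
theorem passesBetween_iff_slope {i : ℕ} (h1 : 1 ≤ i) {p : Plane} {φ a b y : ℝ} (hy : p.2 < y)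
    (hs : 0 < Real.sin φ) (hu : Upward i (Real.cos φ / Real.sin φ)) :
    PassesBetween (cone (theta i) p φ) a b y ↔
      a ≤ p.1 + lo i (Real.cos φ / Real.sin φ) * (y - p.2) ∧
      p.1 + hi i (Real.cos φ / Real.sin φ) * (y - p.2) ≤ b := by
  set v := Real.cos φ / Real.sin φ with hv
  have hlt := hi_sub_lo_pos h1 hu
  have hh : 0 < y - p.2 := by linarith
  have hlt' := mul_lt_mul_of_pos_right hlt hh
  constructor
  · rintro ⟨-, h⟩
    have key : ∀ z, p.1 + lo i v * (y - p.2) < z → z < p.1 + hi i v * (y - p.2) →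
        a ≤ z ∧ z ≤ b := by
      intro z hz1 hz2
      have := h (z, y) ((mem_cone_iff_slope hs hu).2 ⟨by simp only; linarith, by simp only; linarith⟩) rfl
      exact this
    constructor
    · apply le_of_forall_gt_imp_ge_of_dense
      intro z hz
      by_cases hz2 : z < p.1 + hi i v * (y - p.2)
      · exact (key z hz hz2).1
      · have := (key (p.1 + (lo i v * (y - p.2) + hi i v * (y - p.2)) / 2)
          (by linarith) (by linarith)).1
        linarith
    · apply le_of_forall_lt_imp_le_of_dense
      intro z hz
      by_cases hz2 : p.1 + lo i v * (y - p.2) < z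
      · exact (key z hz2 hz).2
      · have := (key (p.1 + (lo i v * (y - p.2) + hi i v * (y - p.2)) / 2)
          (by linarith) (by linarith)).2
        linarith
  · rintro ⟨ha, hb⟩
    constructor
    · refine ⟨(p.1 + (lo i v * (y - p.2) + hi i v * (y - p.2)) / 2, y),
        (mem_cone_iff_slope hs hu).2 ⟨?_, ?_⟩, rfl⟩ <;> simp only <;> linarith
    · rintro ⟨z, y'⟩ hq rfl
      obtain ⟨q1, q2⟩ := (mem_cone_iff_slope hs hu).1 hq
      simp only at q1 q2 ha hb ⊢
      constructor <;> linarith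

/-- A bounding ray that does not rise leaves the section unbounded on its side. -/
theorem upward_of_passesBetween {i : ℕ} (h1 : 1 ≤ i) {p : Plane} {φ a b y : ℝ} (hy : p.2 < y)
    (h : PassesBetween (cone (theta i) p φ) a b y) :
    0 < Real.sin φ ∧ Upward i (Real.cos φ / Real.sin φ) := by
  obtain ⟨⟨q, hq, rfl⟩, hb⟩ := h
  have ht := halfTan_pos h1
  set t := halfTan i with htt
  set s := Real.sin φ
  set c := Real.cos φ
  have hq' := abs_lt.1 ((mem_cone_iff i p q φ).1 hq)
  obtain ⟨e1, e2⟩ := hq'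
  change -(t * ((q.1 - p.1) * c + (q.2 - p.2) * s)) < (q.2 - p.2) * c - (q.1 - p.1) * s at e1
  change (q.2 - p.2) * c - (q.1 - p.1) * s < t * ((q.1 - p.1) * c + (q.2 - p.2) * s) at e2
  have hmem : ∀ z, |(q.2 - p.2) * c - (z - p.1) * s| < t * ((z - p.1) * c + (q.2 - p.2) * s) →
      a ≤ z ∧ z ≤ b := fun z hz => hb (z, q.2) ((mem_cone_iff i p (z, q.2) φ).2 hz) rfl
  have hA : 0 < s - t * c := by
    by_contra hneg
    push Not at hneg
    -- If neither bounding ray rose, the cone would open downwards and miss `q`.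
    have hB : 0 ≤ s + t * c := by
      by_contra hneg2
      push Not at hneg2
      have hq : 0 < q.2 - p.2 := by linarith
      have hs0 : s < 0 := by linarith
      have : 0 < (q.1 - p.1) * c + (q.2 - p.2) * s := by
        by_contra hh
        nlinarith
      rcases le_total 0 c with hc | hc
      · have : 0 < q.1 - p.1 := by by_contra hh; nlinarith
        have a1 := mul_pos this (neg_pos.2 hneg2)
        have a2 := mul_pos hq (show 0 < c - t * s by nlinarith)
        nlinarith
      · have : q.1 - p.1 < 0 := by by_contra hh; nlinarith
        have a1 := mul_nonneg_of_nonpos_of_nonpos this.le hneg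
        have a2 := mul_pos hq (show 0 < -c - t * s by nlinarith)
        nlinarith
    have := hmem (q.1 + (|b| + |q.1| + 1)) (by
      have hM : 0 ≤ |b| + |q.1| + 1 := by positivity
      rw [abs_lt]; constructor <;> nlinarith)
    have h3 := le_abs_self b
    have h4 := neg_abs_le q.1
    linarith
  have hB : 0 < s + t * c := by
    by_contra hneg
    push Not at hneg
    have := hmem (q.1 - (|a| + |q.1| + 1)) (by
      have hM : 0 ≤ |a| + |q.1| + 1 := by positivity
      rw [abs_lt]; constructor <;> nlinarith)
    have h3 := neg_abs_le a
    have h4 := le_abs_self q.1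
    linarith
  have hs : 0 < s := by linarith
  refine ⟨hs, ?_, ?_⟩
  · have : 1 + t * (c / s) = (s + t * c) / s := by field_simp
    rw [this]; positivity
  · have : 1 - t * (c / s) = (s - t * c) / s := by field_simp
    rw [this]; positivity

theorem exists_angle (v : ℝ) : ∃ φ : ℝ, 0 < Real.sin φ ∧ Real.cos φ / Real.sin φ = v := by
  refine ⟨Real.pi / 2 - Real.arctan v, ?_, ?_⟩
  · rw [Real.sin_pi_div_two_sub]; exact Real.cos_arctan_pos v
  · rw [Real.sin_pi_div_two_sub, Real.cos_pi_div_two_sub, ← Real.tan_eq_sin_div_cos,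
      Real.tan_arctan]

/-! ### Right-angle symmetry -/

theorem mem_fourfold {S : Set Plane} {q : Plane} :
    q ∈ fourfold S ↔ q ∈ S ∨ (q.2, -q.1) ∈ S ∨ (-q.1, -q.2) ∈ S ∨ (-q.2, q.1) ∈ S := by
  unfold fourfold
  simp only [Set.mem_iUnion, Finset.mem_range, Set.mem_image, exists_prop]
  constructor
  · rintro ⟨s, hs, g, hg, rfl⟩
    interval_cases s <;> simp [rot, hg]
  · rintro (h | h | h | h)
    · exact ⟨0, by norm_num, _, h, by simp⟩
    · exact ⟨1, by norm_num, _, h, by simp [rot]⟩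
    · exact ⟨2, by norm_num, _, h, by simp [rot]⟩
    · exact ⟨3, by norm_num, _, h, by simp [rot]⟩

theorem rot_mem_fourfold {S : Set Plane} {q : Plane} : rot q ∈ fourfold S ↔ q ∈ fourfold S := by
  simp only [mem_fourfold, rot, neg_neg, Prod.mk.eta]
  tauto

theorem rot_mem_guards {i : ℕ} {x : ℝ} {q : Plane} : rot q ∈ guards i x ↔ q ∈ guards i x := by
  unfold guards firstStep
  simp only [Set.mem_union, rot_mem_fourfold]

theorem rot_mem_cone {i : ℕ} {p q : Plane} {φ : ℝ} :
    rot q ∈ cone (theta i) (rot p) (φ + Real.pi / 2) ↔ q ∈ cone (theta i) p φ := by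
  rw [mem_cone_iff, mem_cone_iff, Real.cos_add_pi_div_two, Real.sin_add_pi_div_two]
  simp only [rot]
  ring_nf

theorem rot_bijective : Function.Bijective rot :=
  ⟨fun a b h => by simp only [rot, Prod.mk.injEq, neg_inj] at h; exact Prod.ext h.2 h.1,
    fun q => ⟨(q.2, -q.1), by simp [rot]⟩⟩

theorem isEmptyOf_rot {i : ℕ} {G : Set Plane} (hG : ∀ q, rot q ∈ G ↔ q ∈ G) {p : Plane} {φ : ℝ} :
    IsEmptyOf (cone (theta i) (rot p) (φ + Real.pi / 2)) G ↔ IsEmptyOf (cone (theta i) p φ) G := by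
  unfold IsEmptyOf
  simp only [Set.eq_empty_iff_forall_notMem, Set.mem_inter_iff, not_and]
  rw [rot_bijective.surjective.forall]
  simp only [rot_mem_cone, hG]

theorem isEmptyOf_rot_iterate {i : ℕ} {G : Set Plane} (hG : ∀ q, rot q ∈ G ↔ q ∈ G) {p : Plane}
    {φ : ℝ} (s : ℕ) :
    IsEmptyOf (cone (theta i) (rot^[s] p) (φ + s * (Real.pi / 2))) G ↔
      IsEmptyOf (cone (theta i) p φ) G := by
  induction s with
  | zero => simp
  | succ s ih =>
    have e : φ + ((s + 1 : ℕ) : ℝ) * (Real.pi / 2) = φ + s * (Real.pi / 2) + Real.pi / 2 := by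
      push_cast; ring
    rw [Function.iterate_succ_apply', e, isEmptyOf_rot hG, ih]

theorem rot_mem_box {s : ℝ} {q : Plane} : rot q ∈ box s ↔ q ∈ box s := by
  simp only [box, rot, Set.mem_ofPred_eq, abs_neg]
  tauto

theorem rot_iterate_mem_box {r : ℝ} {q : Plane} (s : ℕ) : rot^[s] q ∈ box r ↔ q ∈ box r := by
  induction s with
  | zero => simp
  | succ s ih => rw [Function.iterate_succ_apply', rot_mem_box, ih]

/-! ### Cones threading a pair of gaps -/

/-- The upward cone with apex `p` and axis slope `v` crosses height `4i` within `[a, a + 1]` and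
height `2i` within `[b + 1/4, b + 3/4]`. -/
def Threads (i : ℕ) (a b : ℝ) (p : Plane) (v : ℝ) : Prop :=
  Upward i v ∧ p.2 < 2 * (i : ℝ) ∧
  a ≤ p.1 + lo i v * (4 * i - p.2) ∧ p.1 + hi i v * (4 * i - p.2) ≤ a + 1 ∧
  b + 1 / 4 ≤ p.1 + lo i v * (2 * i - p.2) ∧ p.1 + hi i v * (2 * i - p.2) ≤ b + 3 / 4

theorem passesThrough_iff {i : ℕ} (h1 : 1 ≤ i) {k l : ℤ} {p : Plane} {φ : ℝ} :
    PassesThrough i k l p φ ↔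
      0 < Real.sin φ ∧ Threads i k l p (Real.cos φ / Real.sin φ) := by
  have hi0 : (0 : ℝ) < i := by exact_mod_cast h1
  constructor
  · rintro ⟨h2, hP, hQ⟩
    obtain ⟨hs, hu⟩ := upward_of_passesBetween h1 h2 hQ
    rw [passesBetween_iff_slope h1 h2 hs hu] at hQ
    rw [passesBetween_iff_slope h1 (by linarith) hs hu] at hP
    exact ⟨hs, hu, h2, hP.1, hP.2, hQ.1, hQ.2⟩
  · rintro ⟨hs, hu, h2, a1, a2, a3, a4⟩
    refine ⟨h2, ?_, ?_⟩
    · rw [passesBetween_iff_slope h1 (by linarith) hs hu]; exact ⟨a1, a2⟩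
    · rw [passesBetween_iff_slope h1 h2 hs hu]; exact ⟨a3, a4⟩

theorem Threads.mirror {i : ℕ} {a b : ℝ} {p : Plane} {v : ℝ} (h : Threads i a b p v) :
    Threads i (-a - 1) (-b - 1) (-p.1, p.2) (-v) := by
  obtain ⟨hu, h2, a1, a2, a3, a4⟩ := h
  refine ⟨hu.neg, h2, ?_, ?_, ?_, ?_⟩ <;> simp only [lo_neg, hi_neg] <;> linarith

theorem Threads.width_le_one {i : ℕ} {a b : ℝ} {p : Plane} {v : ℝ} (h : Threads i a b p v) :
    (hi i v - lo i v) * (4 * i - p.2) ≤ 1 := by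
  obtain ⟨hu, h2, a1, a2, a3, a4⟩ := h
  linarith

/-- Between heights `2i` and `4i` the right ray must get from at most `b + 3 / 4` to at least `a`
plus the width of the cone. `Threads.lo_le` is the counterpart for the left ray. -/
theorem Threads.le_hi {i : ℕ} {a b : ℝ} {p : Plane} {v : ℝ} (h : Threads i a b p v) :
    a - b - 3 / 4 + (hi i v - lo i v) * (4 * i - p.2) ≤ 2 * i * hi i v := by
  obtain ⟨hu, h2, a1, a2, a3, a4⟩ := h
  linarith

theorem Threads.lo_le {i : ℕ} {a b : ℝ} {p : Plane} {v : ℝ} (h : Threads i a b p v) :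
    (hi i v - lo i v) * (4 * i - p.2) + 2 * i * lo i v ≤ a - b + 3 / 4 := by
  obtain ⟨hu, h2, a1, a2, a3, a4⟩ := h
  linarith

/-! ### Guards of the first step -/

theorem firstUpper_cases {i : ℕ} (h1 : 1 ≤ i) {q : Plane} (hq : q ∈ firstUpper i) :
    (q.2 = 4 * i ∧ |q.1| ≤ 4 * i ∧ (-(i : ℝ) < q.1 → q.1 < i → ∃ m : ℤ, q.1 = m)) ∨
    (q.2 = 2 * i ∧ |q.1| ≤ i ∧ ∃ m : ℤ, q.1 = m ∨ q.1 = m + 1 / 4 ∨ q.1 = m + 3 / 4) := by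
  have hi1 : (1 : ℝ) ≤ i := by exact_mod_cast h1
  rcases hq with ⟨m, hm1, hm2, hq⟩ | ⟨m, hm1, hm2, hm3, hq⟩
  · have e1 : -(i : ℝ) ≤ m := by exact_mod_cast hm1
    have e2 : (m : ℝ) + 1 ≤ i := by exact_mod_cast hm2
    simp only [patternA, Set.mem_insert_iff, Set.mem_singleton_iff] at hq
    rcases hq with rfl | rfl | rfl | rfl | rfl | rfl
    · exact Or.inl ⟨rfl, abs_le.2 ⟨by simp only; linarith, by simp only; linarith⟩, fun _ _ => ⟨m, rfl⟩⟩
    · exact Or.inl ⟨rfl, abs_le.2 ⟨by simp only; linarith, by simp only; linarith⟩,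
        fun _ _ => ⟨m + 1, by push_cast; rfl⟩⟩
    · exact Or.inr ⟨rfl, abs_le.2 ⟨by simp only; linarith, by simp only; linarith⟩, m, by simp⟩
    · exact Or.inr ⟨rfl, abs_le.2 ⟨by simp only; linarith, by simp only; linarith⟩, m, by simp⟩
    · exact Or.inr ⟨rfl, abs_le.2 ⟨by simp only; linarith, by simp only; linarith⟩, m, by simp⟩
    · exact Or.inr ⟨rfl, abs_le.2 ⟨by simp only; linarith, by simp only; linarith⟩, m + 1, by simp⟩
  · have e1 : -(4 * (i : ℝ)) ≤ m := by exact_mod_cast hm1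
    have e2 : (m : ℝ) + 1 ≤ 4 * i := by exact_mod_cast hm2
    simp only [patternB, Set.mem_insert_iff, Set.mem_singleton_iff] at hq
    rcases hq with rfl | rfl | rfl
    · exact Or.inl ⟨rfl, abs_le.2 ⟨by simp only; linarith, by simp only; linarith⟩, fun _ _ => ⟨m, rfl⟩⟩
    · refine Or.inl ⟨rfl, abs_le.2 ⟨by simp only; linarith, by simp only; linarith⟩, fun a b => ?_⟩
      exfalso
      simp only at a b
      have a' : -(i : ℤ) < m + 1 := by
        have : -(i : ℝ) < m + 1 := by linarith
        exact_mod_cast this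
      have b' : m < (i : ℤ) := by
        have : (m : ℝ) < i := by linarith
        exact_mod_cast this
      exact hm3 ⟨by omega, b'⟩
    · exact Or.inl ⟨rfl, abs_le.2 ⟨by simp only; linarith, by simp only; linarith⟩,
        fun _ _ => ⟨m + 1, by push_cast; rfl⟩⟩

theorem firstUpper_bounds {i : ℕ} (h1 : 1 ≤ i) {q : Plane} (hq : q ∈ firstUpper i) :
    2 * (i : ℝ) ≤ q.2 ∧ q.2 ≤ 4 * i ∧ |q.1| ≤ 4 * i := by
  have hi1 : (1 : ℝ) ≤ i := by exact_mod_cast h1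
  rcases firstUpper_cases h1 hq with ⟨a, b, -⟩ | ⟨a, b, -⟩
  · exact ⟨by linarith, by linarith, b⟩
  · exact ⟨by linarith, by linarith, by linarith⟩

/-- No upper guard lies strictly inside the two gaps. The left and right guards have abscissa at
least `2i` in absolute value and height at most `4i`, where the cone stays closer to the vertical
axis; the lower guards lie below the apex. -/
theorem PassesThrough.isEmptyOf_firstStep {i : ℕ} (h1 : 1 ≤ i) {k l : ℤ} {p : Plane} {φ : ℝ}
    (h : PassesThrough i k l p φ) (hk : -(i : ℤ) ≤ k ∧ k < i) (hp2 : 0 ≤ p.2)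
    (hp1 : |p.1| < 2 * i) : IsEmptyOf (cone (theta i) p φ) (firstStep i) := by
  have hi1 : (1 : ℝ) ≤ i := by exact_mod_cast h1
  obtain ⟨hs, hu, h2, a1, a2, a3, a4⟩ := (passesThrough_iff h1).1 h
  have k1 : -(i : ℝ) ≤ k := by exact_mod_cast hk.1
  have k2 : (k : ℝ) + 1 ≤ i := by exact_mod_cast hk.2
  obtain ⟨hp3, hp4⟩ := abs_lt.1 hp1
  unfold IsEmptyOf
  rw [Set.eq_empty_iff_forall_notMem]
  rintro q ⟨hq, hg⟩
  obtain ⟨q1, q2⟩ := (mem_cone_iff_slope hs hu).1 hq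
  have hlt := hi_sub_lo_pos h1 hu
  set u := lo i (Real.cos φ / Real.sin φ)
  set u' := hi i (Real.cos φ / Real.sin φ)
  have hq2 : 0 < q.2 - p.2 := by
    by_contra hneg
    push Not at hneg
    nlinarith
  rcases mem_fourfold.1 hg with hg | hg | hg | hg
  · rcases firstUpper_cases h1 hg with ⟨e, -, he⟩ | ⟨e, -, m, he⟩
    · rw [e] at q1 q2
      obtain ⟨m, hm⟩ := he (by linarith) (by linarith)
      have b1 : k < m := by
        have : (k : ℝ) < m := by linarith
        exact_mod_cast this
      have b2 : m < k + 1 := by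
        have : (m : ℝ) < k + 1 := by linarith
        exact_mod_cast this
      omega
    · rw [e] at q1 q2
      have b1 : (l : ℝ) + 1 / 4 < q.1 := by linarith
      have b2 : q.1 < (l : ℝ) + 3 / 4 := by linarith
      rcases he with he | he | he
      · have c1 : l < m := by
          have : (l : ℝ) < m := by linarith
          exact_mod_cast this
        have c2 : m < l + 1 := by
          have : (m : ℝ) < l + 1 := by linarith
          exact_mod_cast this
        omega
      · have c1 : l < m := by
          have : (l : ℝ) < m := by linarith
          exact_mod_cast this
        have c2 : m < l + 1 := by
          have : (m : ℝ) < l + 1 := by linarith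
          exact_mod_cast this
        omega
      · have c1 : l < m + 1 := by
          have : (l : ℝ) < m + 1 := by linarith
          exact_mod_cast this
        have c2 : m < l := by
          have : (m : ℝ) < l := by linarith
          exact_mod_cast this
        omega
  · obtain ⟨c1, -, c2⟩ := firstUpper_bounds h1 hg
    simp only at c1 c2
    obtain ⟨-, c3⟩ := abs_le.1 c2
    have d1 : (p.1 + u * (q.2 - p.2)) * (4 * i - p.2) < -(2 * i) * (4 * i - p.2) :=
      mul_lt_mul_of_pos_right (by linarith) (by linarith)
    nlinarith [mul_le_mul_of_nonneg_right a1 hq2.le]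
  · obtain ⟨c1, -, -⟩ := firstUpper_bounds h1 hg
    simp only at c1
    linarith
  · obtain ⟨c1, -, c2⟩ := firstUpper_bounds h1 hg
    simp only [abs_neg] at c1 c2
    obtain ⟨-, c3⟩ := abs_le.1 c2
    have d1 : 2 * i * (4 * i - p.2) < (p.1 + u' * (q.2 - p.2)) * (4 * i - p.2) :=
      mul_lt_mul_of_pos_right (by linarith) (by linarith)
    nlinarith [mul_le_mul_of_nonneg_right a2 hq2.le]

/-! ### The deepest cones -/

/-- The slope of the right bounding ray of the deepest cone, for an offset `d > 0`. -/
noncomputable def raySlope (i : ℕ) (d : ℝ) : ℝ := (d + 1 / 4) / (2 * i)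

/-- The slope of the medial axis of the deepest cone, for an offset `d > 0`. -/
noncomputable def axisSlope (i : ℕ) (d : ℝ) : ℝ :=
  (raySlope i d - halfTan i) / (1 + raySlope i d * halfTan i)

theorem raySlope_mul {i : ℕ} (h1 : 1 ≤ i) (d : ℝ) : 2 * i * raySlope i d = d + 1 / 4 := by
  have hi0 : (0 : ℝ) < i := by exact_mod_cast h1
  unfold raySlope; field_simp

theorem raySlope_pos {i : ℕ} (h1 : 1 ≤ i) {d : ℝ} (hd : 1 ≤ d) : 0 < raySlope i d := by
  have hi0 : (0 : ℝ) < i := by exact_mod_cast h1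
  unfold raySlope; positivity

theorem raySlope_le {i : ℕ} (h1 : 1 ≤ i) {d : ℝ} (hd : d ≤ 2 * i - 1) :
    raySlope i d ≤ 1 - 3 * halfTan i := by
  have hi0 : (0 : ℝ) < i := by exact_mod_cast h1
  have e := raySlope_mul h1 d
  have e2 := halfTan_mul h1
  have : 2 * (i : ℝ) * raySlope i d ≤ 2 * i * (1 - 3 * halfTan i) := by linarith
  exact le_of_mul_le_mul_left this (by linarith)

theorem axisSlope_mul {i : ℕ} (h1 : 1 ≤ i) {d : ℝ} (hd : 1 ≤ d) :
    axisSlope i d * (1 + raySlope i d * halfTan i) = raySlope i d - halfTan i := by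
  have := raySlope_pos h1 hd
  have := halfTan_pos h1
  unfold axisSlope
  field_simp

theorem two_mul_axisSlope_mul {i : ℕ} (h1 : 1 ≤ i) {d : ℝ} (hd : 1 ≤ d) :
    2 * i * axisSlope i d * (1 + raySlope i d * halfTan i) = d := by
  linear_combination 2 * i * axisSlope_mul h1 hd + raySlope_mul h1 d - 2 * halfTan_mul h1

theorem axisSlope_pos {i : ℕ} (h1 : 1 ≤ i) {d : ℝ} (hd : 1 ≤ d) : 0 < axisSlope i d := by
  have hi0 : (0 : ℝ) < i := by exact_mod_cast h1
  have e := raySlope_mul h1 d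
  have e2 := halfTan_mul h1
  have a := raySlope_pos h1 hd
  have b := halfTan_pos h1
  unfold axisSlope
  apply div_pos _ (by positivity)
  have : 0 < 2 * i * (raySlope i d - halfTan i) := by linarith
  exact pos_of_mul_pos_right this (by linarith)

theorem upward_axisSlope {i : ℕ} (h1 : 1 ≤ i) {d : ℝ} (hd : 1 ≤ d) :
    Upward i (axisSlope i d) := by
  have a := raySlope_pos h1 hd
  have b := halfTan_pos h1
  have c := axisSlope_pos h1 hd
  have e := axisSlope_mul h1 hd
  refine ⟨by positivity, ?_⟩
  have : (1 - halfTan i * axisSlope i d) * (1 + raySlope i d * halfTan i)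
      = 1 + halfTan i ^ 2 := by linear_combination -halfTan i * e
  by_contra hneg
  have h3 : 0 < 1 + raySlope i d * halfTan i := by positivity
  nlinarith [sq_nonneg (halfTan i)]

theorem hi_axisSlope {i : ℕ} (h1 : 1 ≤ i) {d : ℝ} (hd : 1 ≤ d) :
    hi i (axisSlope i d) = raySlope i d := by
  have hu := upward_axisSlope h1 hd
  have e := axisSlope_mul h1 hd
  unfold hi
  rw [div_eq_iff hu.2.ne']
  linarith

theorem axisSlope_le {i : ℕ} (h1 : 1 ≤ i) {d : ℝ} (hd : 1 ≤ d) (hd' : d ≤ 2 * i - 1) :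
    axisSlope i d ≤ 1 - 4 * halfTan i := by
  have a := raySlope_pos h1 hd
  have b := halfTan_pos h1
  have c := axisSlope_pos h1 hd
  have e := axisSlope_mul h1 hd
  have := raySlope_le h1 hd'
  nlinarith [mul_pos c (mul_pos a b)]

/-- The value `4 / (9i)` exceeds `1 / (3i)`, which bounds the rays of wanted cones; it also
determines how large `x` has to be. -/
theorem le_axisSlope {i : ℕ} (h1 : 1 ≤ i) {d : ℝ} (hd : 1 ≤ d) (hd' : d ≤ 2 * i - 1) :
    4 ≤ 9 * i * axisSlope i d := by
  have hi0 : (0 : ℝ) < i := by exact_mod_cast h1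
  have a := raySlope_pos h1 hd
  have b := halfTan_pos h1
  have b' := halfTan_le h1
  have c := axisSlope_pos h1 hd
  have e := two_mul_axisSlope_mul h1 hd
  have := raySlope_le h1 hd'
  have h3 : 1 + raySlope i d * halfTan i ≤ 9 / 8 := by nlinarith
  have h4 : 0 < 2 * i * axisSlope i d := by positivity
  nlinarith

theorem raySlope_le_mul_axisSlope {i : ℕ} (h1 : 1 ≤ i) {d : ℝ} (hd : 1 ≤ d)
    (hd' : d ≤ 2 * i - 1) : 32 * raySlope i d ≤ 45 * axisSlope i d := by
  have hi0 : (0 : ℝ) < i := by exact_mod_cast h1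
  have a := raySlope_pos h1 hd
  have b := halfTan_pos h1
  have b' := halfTan_le h1
  have c := axisSlope_pos h1 hd
  have e := two_mul_axisSlope_mul h1 hd
  have e' := raySlope_mul h1 d
  have := raySlope_le h1 hd'
  have h3 : 1 + raySlope i d * halfTan i ≤ 9 / 8 := by nlinarith
  have h4 : 0 < 2 * i * axisSlope i d := by positivity
  have h5 : d ≤ 2 * i * axisSlope i d * (9 / 8) := by nlinarith
  have h6 : 2 * i * (32 * raySlope i d) ≤ 2 * i * (45 * axisSlope i d) := by nlinarith
  exact le_of_mul_le_mul_left h6 (by linarith)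

theorem axisSlope_strictMono {i : ℕ} (h1 : 1 ≤ i) {d d' : ℝ} (hd : 1 ≤ d) (h : d < d') :
    axisSlope i d < axisSlope i d' := by
  have hi0 : (0 : ℝ) < i := by exact_mod_cast h1
  have a := raySlope_pos h1 hd
  have a' := raySlope_pos h1 (hd.trans h.le)
  have b := halfTan_pos h1
  have : raySlope i d < raySlope i d' := by
    unfold raySlope
    gcongr
  unfold axisSlope
  rw [div_lt_div_iff₀ (by positivity) (by positivity)]
  nlinarith [mul_pos b b]

theorem width_mul {i : ℕ} {v : ℝ} (hu : Upward i v) :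
    (hi i v - lo i v) * ((1 + halfTan i * v) * (1 - halfTan i * v)) =
      2 * halfTan i * (1 + v ^ 2) := by
  rw [hi_sub_lo hu, div_mul_cancel₀ _ (mul_pos hu.1 hu.2).ne']

/-- In `hi_sub_lo` the numerator grows with `v ^ 2` and the denominator `1 - halfTan i ^ 2 * v ^ 2`
shrinks. -/
theorem width_lt_of_lt {i : ℕ} (h1 : 1 ≤ i) {v v' : ℝ} (h0 : 0 ≤ v) (hv : v < v')
    (hu' : Upward i v') : hi i v - lo i v < hi i v' - lo i v' := by
  have ht := halfTan_pos h1
  have hlt : halfTan i * v < halfTan i * v' := mul_lt_mul_of_pos_left hv ht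
  have hu : Upward i v := ⟨by positivity, by linarith [hu'.2]⟩
  rw [hi_sub_lo hu, hi_sub_lo hu', div_lt_div_iff₀ (mul_pos hu.1 hu.2) (mul_pos hu'.1 hu'.2)]
  have hsq : v ^ 2 < v' ^ 2 := by gcongr
  have h2 : 0 < halfTan i ^ 2 := by positivity
  have key : (1 + v ^ 2) * ((1 + halfTan i * v') * (1 - halfTan i * v'))
      < (1 + v' ^ 2) * ((1 + halfTan i * v) * (1 - halfTan i * v)) := by nlinarith
  nlinarith

theorem width_mul_hi {i : ℕ} {v : ℝ} (hu : Upward i v) :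
    (hi i v - lo i v) * (1 - halfTan i ^ 2 + 2 * halfTan i * hi i v) =
      2 * halfTan i * (1 + hi i v ^ 2) := by
  have a := hu.1.ne'
  have b := hu.2.ne'
  rw [hi_sub_lo hu]
  unfold hi
  rw [div_mul_eq_mul_div, div_eq_iff (mul_ne_zero a b)]
  field_simp
  ring

theorem hi_lt_hi {i : ℕ} (h1 : 1 ≤ i) {v v' : ℝ} (hv : v < v') (hu : Upward i v)
    (hu' : Upward i v') : hi i v < hi i v' := by
  have ht := halfTan_pos h1
  unfold hi
  rw [div_lt_div_iff₀ hu.2 hu'.2]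
  nlinarith [mul_pos ht ht]

/-- The depth below the top row is at most the usable part of the top gap divided by the width per
unit height. A larger tilt widens the cone. A smaller tilt narrows it, but the right ray, held by
the right guard of `Q`, then gives up `2i` times its loss of slope from the top gap, and this costs
more than the narrowing gains. -/
theorem Threads.depth_mul_lt {i : ℕ} (h1 : 1 ≤ i) {a b : ℝ} {p : Plane} {v : ℝ}
    (h : Threads i a b p v) (hd : 1 ≤ a - b) (hne : v ≠ axisSlope i (a - b)) :
    (4 * i - p.2) * (hi i (axisSlope i (a - b)) - lo i (axisSlope i (a - b))) < 1 := by
  have hi0 : (0 : ℝ) < i := by exact_mod_cast h1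
  have ht := halfTan_pos h1
  have ht' := halfTan_le h1
  have hu := upward_axisSlope h1 hd
  have hpos := axisSlope_pos h1 hd
  have hw := h.width_le_one
  have hb := h.le_hi
  obtain ⟨hu', hp, -⟩ := h
  have hh : 0 < 4 * i - p.2 := by linarith
  rcases lt_or_gt_of_ne hne with hlt | hgt
  · have e1 := width_mul_hi hu
    have e2 := width_mul_hi hu'
    have e3 := hi_lt_hi h1 hlt hu' hu
    rw [hi_axisSlope h1 hd] at e1 e3 ⊢
    have e4 := raySlope_mul h1 (a - b)
    have e5 := raySlope_pos h1 hd
    have e6 : 0 < (hi i v - lo i v) * (4 * i - p.2) :=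
      mul_pos (by linarith [hi_sub_lo_pos h1 hu']) hh
    have i1 : (1 : ℝ) ≤ i := by exact_mod_cast h1
    set u := hi i v
    set r := raySlope i (a - b)
    set W := r - lo i (axisSlope i (a - b))
    set h := 4 * i - p.2
    set t := halfTan i
    set w := u - lo i v
    have hu0 : 0 < u := by
      have : 0 < 2 * i * u := by linarith
      exact pos_of_mul_pos_right this (by linarith)
    -- Since `2 * i * r = a - b + 1 / 4`, `Threads.le_hi` leaves only `1 - 2 * i * (r - u)` of the
    -- top gap.
    have f1 : h * (2 * t * (1 + u ^ 2)) ≤ (1 - 2 * i * (r - u)) * (1 - t ^ 2 + 2 * t * u) := by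
      rw [← e2, ← mul_assoc]
      apply mul_le_mul_of_nonneg_right _ (by nlinarith)
      linarith
    have f2 : 0 < 1 - 2 * i * (r - u) := by linarith
    have f3 : (1 - 2 * i * (r - u)) * (1 - t ^ 2 + 2 * t * u) <
        (1 - 2 * i * (r - u)) * (1 - t ^ 2 + 2 * t * r) := by
      apply mul_lt_mul_of_pos_left _ f2
      nlinarith
    -- The comparison of loss with gain; it rests on `2 * r ≤ 1 + r ^ 2`.
    have f4 : (1 - 2 * i * (r - u)) * (1 + r ^ 2) ≤ 1 + u ^ 2 := by
      have g1 : 2 * r ≤ 2 * i * (1 + r ^ 2) := by nlinarith [sq_nonneg (r - 1)]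
      have g2 : 0 < r - u := by linarith
      nlinarith [mul_le_mul_of_nonneg_left g1 g2.le, sq_nonneg (r - u)]
    have hX : 0 < 1 - t ^ 2 + 2 * t * r := by nlinarith
    have f5 : h * (2 * t * (1 + u ^ 2)) * (1 + r ^ 2) <
        (1 - 2 * i * (r - u)) * (1 - t ^ 2 + 2 * t * r) * (1 + r ^ 2) :=
      mul_lt_mul_of_pos_right (by linarith) (by positivity)
    have f6 := mul_le_mul_of_nonneg_right f4 hX.le
    have f7 : (h * W) * ((1 - t ^ 2 + 2 * t * r) * (1 + u ^ 2)) <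
        1 * ((1 - t ^ 2 + 2 * t * r) * (1 + u ^ 2)) := by
      have : (h * W) * ((1 - t ^ 2 + 2 * t * r) * (1 + u ^ 2)) =
        h * (2 * t * (1 + u ^ 2)) * (1 + r ^ 2) := by linear_combination h * (1 + u ^ 2) * e1
      rw [this]
      linarith
    exact lt_of_mul_lt_mul_right f7 (by positivity)
  · have := width_lt_of_lt h1 hpos.le hgt hu'
    nlinarith

/-- This puts the apex of the deepest cone below the row at height `2i`: width 1 is reached only at
a distance above `2i` from the apex. -/
theorem two_mul_width_lt_one {i : ℕ} (h1 : 1 ≤ i) {d : ℝ} (hd : 1 ≤ d) (hd' : d ≤ 2 * i - 1) :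
    2 * i * (hi i (axisSlope i d) - lo i (axisSlope i d)) < 1 := by
  have hi0 : (0 : ℝ) < i := by exact_mod_cast h1
  have ht := halfTan_pos h1
  have ht' := halfTan_le h1
  have e2 := halfTan_mul h1
  have hu := upward_axisSlope h1 hd
  have hpos := axisSlope_pos h1 hd
  have hle := axisSlope_le h1 hd hd'
  have e := width_mul hu
  have hX := mul_pos hu.1 hu.2
  set v := axisSlope i d
  set t := halfTan i
  set W := hi i v - lo i v
  have hv2 : v ^ 2 ≤ 1 - 4 * t := by nlinarith
  have key : (2 * i * W) * ((1 + t * v) * (1 - t * v)) < 1 * ((1 + t * v) * (1 - t * v)) := by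
    have : (2 * i * W) * ((1 + t * v) * (1 - t * v)) = (1 + v ^ 2) / 2 := by
      linear_combination 2 * i * e + 4 * (1 + v ^ 2) * e2
    rw [this]
    nlinarith [mul_le_mul_of_nonneg_left hv2 (sq_nonneg t)]
  exact lt_of_mul_lt_mul_right key hX.le

theorem exists_threads_of_pos {i : ℕ} (h1 : 1 ≤ i) {a b : ℝ} (ha : a + 1 ≤ i) (hb : -(i : ℝ) ≤ b)
    (hd : 1 ≤ a - b) (hd' : a - b ≤ 2 * i - 1) :
    ∃ p : Plane, Threads i a b p (axisSlope i (a - b)) ∧ 0 ≤ p.2 ∧ |p.1| < 2 * i ∧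
      ∀ (p' : Plane) (v : ℝ), Threads i a b p' v →
        p.2 ≤ p'.2 ∧ (p'.2 ≤ p.2 → v = axisSlope i (a - b)) := by
  have hi0 : (0 : ℝ) < i := by exact_mod_cast h1
  have ht := halfTan_pos h1
  have ht' := halfTan_le h1
  have e2 := halfTan_mul h1
  have hu := upward_axisSlope h1 hd
  have hpos := axisSlope_pos h1 hd
  have hle := axisSlope_le h1 hd hd'
  have hray := raySlope_pos h1 hd
  have hray' := raySlope_mul h1 (a - b)
  have hax := axisSlope_mul h1 hd
  have hrle := raySlope_le h1 hd'
  have hW1 := two_mul_width_lt_one h1 hd hd'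
  have hW2 := le_hi_sub_lo h1 hu
  have hW0 := hi_sub_lo_pos h1 hu
  have hopt : ∀ (p' : Plane) (v : ℝ), Threads i a b p' v → v ≠ axisSlope i (a - b) →
      (4 * i - p'.2) * (hi i (axisSlope i (a - b)) - lo i (axisSlope i (a - b))) < 1 :=
    fun p' v h hne => h.depth_mul_lt h1 hd hne
  have hopt' : ∀ (p' : Plane), Threads i a b p' (axisSlope i (a - b)) →
      (hi i (axisSlope i (a - b)) - lo i (axisSlope i (a - b))) * (4 * i - p'.2) ≤ 1 :=
    fun p' h => h.width_le_one
  rw [hi_axisSlope h1 hd] at *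
  set v := axisSlope i (a - b) with hv
  set t := halfTan i
  set r := raySlope i (a - b)
  obtain ⟨W, hlo⟩ : ∃ W, lo i v = r - W := ⟨r - lo i v, by ring⟩
  simp only [hlo, sub_sub_cancel] at hW1 hW2 hW0 hopt hopt'
  have hWpos : 0 < W := by linarith
  set H := 1 / W with hH
  have hWH : W * H = 1 := by rw [hH]; field_simp
  have hH0 : 0 < H := by positivity
  have hH1 : 2 * i < H := by nlinarith
  have hH2 : H * (1 + v ^ 2) ≤ 4 * i := by
    have : H * (2 * t * (1 + v ^ 2)) ≤ H * W := mul_le_mul_of_nonneg_left hW2 hH0.le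
    have h8 : 4 * i * (H * (2 * t * (1 + v ^ 2))) = H * (1 + v ^ 2) := by
      linear_combination 8 * H * (1 + v ^ 2) * e2
    nlinarith
  have hH3 : H ≤ 4 * i := by nlinarith [sq_nonneg v]
  -- Follow the right ray down from the guard `(a + 1, 4i)` by `H = 1 / W`, so that the width at the
  -- top is exactly 1 and both top guards are touched.
  refine ⟨(a + 1 - r * H, 4 * i - H), ⟨hu, ?_, ?_, ?_, ?_, ?_⟩, ?_, ?_, ?_⟩
  · simp only; linarith
  · simp only [hlo]; linarith
  · simp only [hi_axisSlope h1 hd, hv]; linarith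
  · simp only [hlo]
    have h9 : 1 / 2 ≤ 2 * i * W := by
      have : 2 * i * (2 * t) ≤ 2 * i * W :=
        mul_le_mul_of_nonneg_left (by nlinarith [sq_nonneg v]) (by linarith)
      linarith
    linarith
  · simp only [hi_axisSlope h1 hd, hv]; linarith
  · simp only; linarith
  · simp only
    rw [abs_lt]
    have h10 : r ≤ v + 1 / 4 := by nlinarith [mul_pos hray ht]
    have h11 : r * (H - 2 * i) ≤ i := by
      have g1 : r * (H - 2 * i) * (1 + v ^ 2) ≤ (v + 1 / 4) * (2 * i * (1 - v ^ 2)) := by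
        have : (H - 2 * i) * (1 + v ^ 2) ≤ 2 * i * (1 - v ^ 2) := by linarith
        have g0 : 0 ≤ (H - 2 * i) * (1 + v ^ 2) := mul_nonneg (by linarith) (by positivity)
        calc r * (H - 2 * i) * (1 + v ^ 2) = r * ((H - 2 * i) * (1 + v ^ 2)) := by ring
          _ ≤ (v + 1 / 4) * (2 * i * (1 - v ^ 2)) := mul_le_mul h10 this g0 (by linarith)
      -- The difference of the sides is a cubic whose minimum for positive `v` is near `2 / 5`,
      -- hence the squares supplied.
      have g2 : (v + 1 / 4) * (2 * (1 - v ^ 2)) ≤ 1 + v ^ 2 := by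
        nlinarith [mul_nonneg hpos.le (sq_nonneg (v - 2 / 5)), sq_nonneg (v - 2 / 5)]
      have g3 : r * (H - 2 * i) * (1 + v ^ 2) ≤ i * (1 + v ^ 2) := by nlinarith
      exact le_of_mul_le_mul_right g3 (by positivity)
    constructor
    · linarith
    · nlinarith
  · intro p' v' h
    by_cases hne : v' = v
    · subst hne
      refine ⟨?_, fun _ => rfl⟩
      have := hopt' p' h
      have : W * (4 * i - p'.2) ≤ W * H := by linarith
      have := le_of_mul_le_mul_left this hWpos
      simp only; linarith
    · have := hopt p' v' h hne
      have : W * (4 * i - p'.2) < W * H := by linarith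
      have := lt_of_mul_lt_mul_left this hWpos.le
      simp only
      exact ⟨by linarith, fun _ => by linarith⟩

/-- The slope of the medial axis of the deepest cone through `P_k` and `Q_l` with offset
`d = k - l ≠ 0`. -/
noncomputable def deepSlope (i : ℕ) (d : ℝ) : ℝ :=
  if 0 < d then axisSlope i d else -axisSlope i (-d)

theorem deepSlope_of_pos {i : ℕ} {d : ℝ} (h : 0 < d) : deepSlope i d = axisSlope i d := if_pos h

theorem deepSlope_of_neg {i : ℕ} {d : ℝ} (h : d < 0) : deepSlope i d = -axisSlope i (-d) :=
  if_neg h.not_gt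

/-- Reflection in the vertical axis sends the cell `[k, k + 1]` to `[-k - 1, -k]` and reduces `k <
l` to `k > l`. The last clause makes the slope of a deepest cone unique, which gives the far guards
explicit coordinates. -/
theorem exists_deepest_threads {i : ℕ} (h1 : 1 ≤ i) {k l : ℤ} (hk : -(i : ℤ) ≤ k ∧ k < i)
    (hl : -(i : ℤ) ≤ l ∧ l < i) (hkl : k ≠ l) :
    ∃ p : Plane, Threads i k l p (deepSlope i (k - l)) ∧ 0 ≤ p.2 ∧ |p.1| < 2 * i ∧
      ∀ (p' : Plane) (v : ℝ), Threads i k l p' v →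
        p.2 ≤ p'.2 ∧ (p'.2 ≤ p.2 → v = deepSlope i (k - l)) := by
  have k1 : -(i : ℝ) ≤ k := by exact_mod_cast hk.1
  have k2 : (k : ℝ) + 1 ≤ i := by exact_mod_cast hk.2
  have l1 : -(i : ℝ) ≤ l := by exact_mod_cast hl.1
  have l2 : (l : ℝ) + 1 ≤ i := by exact_mod_cast hl.2
  rcases lt_or_gt_of_ne hkl with h | h
  · have h' : (k : ℝ) + 1 ≤ l := by exact_mod_cast h
    have e : ((-(k : ℝ) - 1) - (-(l : ℝ) - 1)) = -(k - l) := by ring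
    obtain ⟨p, hp, hp2, hp1, hmin⟩ := exists_threads_of_pos h1 (a := -(k : ℝ) - 1)
      (b := -(l : ℝ) - 1) (by linarith) (by linarith) (by linarith) (by linarith)
    rw [e] at hp hmin
    rw [deepSlope_of_neg (show (k : ℝ) - l < 0 by linarith)]
    refine ⟨(-p.1, p.2), ?_, hp2, by simpa using hp1, ?_⟩
    · have := hp.mirror
      simpa using this
    · intro p' v h
      obtain ⟨m1, m2⟩ := hmin _ _ h.mirror
      exact ⟨m1, fun hle => by rw [← m2 hle]; ring⟩
  · have h' : (l : ℝ) + 1 ≤ k := by exact_mod_cast h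
    rw [deepSlope_of_pos (show 0 < (k : ℝ) - l by linarith)]
    exact exists_threads_of_pos h1 (by linarith) (by linarith) (by linarith) (by linarith)

theorem exists_isDeepest {i : ℕ} (h1 : 1 ≤ i) {k l : ℤ} (hk : -(i : ℤ) ≤ k ∧ k < i)
    (hl : -(i : ℤ) ≤ l ∧ l < i) (hkl : k ≠ l) : ∃ p φ, IsDeepest i k l p φ := by
  obtain ⟨p, hp, hp2, hp1, hmin⟩ := exists_deepest_threads h1 hk hl hkl
  obtain ⟨φ, hs, hφ⟩ := exists_angle (deepSlope i (k - l))
  rw [← hφ] at hp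
  have hpt := (passesThrough_iff h1).2 ⟨hs, hp⟩
  exact ⟨p, φ, ⟨hpt, hpt.isEmptyOf_firstStep h1 hk hp2 hp1⟩,
    fun p' φ' h _ => (hmin p' _ ((passesThrough_iff h1).1 h).2).1⟩

theorem IsDeepest.slope {i : ℕ} (h1 : 1 ≤ i) {k l : ℤ} (hk : -(i : ℤ) ≤ k ∧ k < i)
    (hl : -(i : ℤ) ≤ l ∧ l < i) (hkl : k ≠ l) {p : Plane} {φ : ℝ} (h : IsDeepest i k l p φ) :
    0 < Real.sin φ ∧ Real.cos φ / Real.sin φ = deepSlope i (k - l) := by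
  obtain ⟨p', hp', hp2, hp1, hmin⟩ := exists_deepest_threads h1 hk hl hkl
  obtain ⟨φ', hs', hφ'⟩ := exists_angle (deepSlope i (k - l))
  rw [← hφ'] at hp'
  have hpt := (passesThrough_iff h1).2 ⟨hs', hp'⟩
  obtain ⟨hs, ht⟩ := (passesThrough_iff h1).1 h.1.1
  exact ⟨hs, (hmin p _ ht).2 (h.2 p' φ' hpt (hpt.isEmptyOf_firstStep h1 hk hp2 hp1))⟩

theorem abs_deepSlope_lt_one {i : ℕ} (h1 : 1 ≤ i) {k l : ℤ} (hk : -(i : ℤ) ≤ k ∧ k < i)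
    (hl : -(i : ℤ) ≤ l ∧ l < i) (hkl : k ≠ l) : |deepSlope i (k - l)| < 1 := by
  have ht := halfTan_pos h1
  have k1 : -(i : ℝ) ≤ k := by exact_mod_cast hk.1
  have k2 : (k : ℝ) + 1 ≤ i := by exact_mod_cast hk.2
  have l1 : -(i : ℝ) ≤ l := by exact_mod_cast hl.1
  have l2 : (l : ℝ) + 1 ≤ i := by exact_mod_cast hl.2
  rcases lt_or_gt_of_ne hkl with h | h
  · have h' : (k : ℝ) + 1 ≤ l := by exact_mod_cast h
    rw [deepSlope_of_neg (show (k : ℝ) - l < 0 by linarith), abs_neg,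
      abs_of_pos (axisSlope_pos h1 (by linarith))]
    linarith [axisSlope_le h1 (d := -((k : ℝ) - l)) (by linarith) (by linarith)]
  · have h' : (l : ℝ) + 1 ≤ k := by exact_mod_cast h
    rw [deepSlope_of_pos (show 0 < (k : ℝ) - l by linarith),
      abs_of_pos (axisSlope_pos h1 (by linarith))]
    linarith [axisSlope_le h1 (d := (k : ℝ) - l) (by linarith) (by linarith)]

/-- All these slopes are below 1 in absolute value, so the rays leave `box x` through its top side.
-/
theorem mem_secondUpper_iff {i : ℕ} (h1 : 1 ≤ i) {x : ℝ} (hx : 0 < x) {g : Plane} :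
    g ∈ secondUpper i x ↔ ∃ k l : ℤ, (-(i : ℤ) ≤ k ∧ k < i) ∧ (-(i : ℤ) ≤ l ∧ l < i) ∧ k ≠ l ∧
      g = (deepSlope i (k - l) * x, x) := by
  have aux : ∀ (k l : ℤ), (-(i : ℤ) ≤ k ∧ k < i) → (-(i : ℤ) ≤ l ∧ l < i) → k ≠ l → ∀ s : ℝ,
      0 < s → max |deepSlope i (k - l) * s| |s| = s := by
    intro k l hk hl hkl s hs
    rw [abs_mul, abs_of_pos hs]
    apply max_eq_right
    have := abs_deepSlope_lt_one h1 hk hl hkl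
    nlinarith
  constructor
  · rintro ⟨k, l, hk, hl, hkl, p, φ, hdeep, r, hr, rfl, hmax⟩
    refine ⟨k, l, hk, hl, hkl, ?_⟩
    obtain ⟨hs, he⟩ := hdeep.slope h1 hk hl hkl
    have hc : r * Real.cos φ = deepSlope i (k - l) * (r * Real.sin φ) := by
      rw [← he]; field_simp
    simp only [hc] at hmax ⊢
    rw [aux k l hk hl hkl _ (by positivity)] at hmax
    rw [hmax]
  · rintro ⟨k, l, hk, hl, hkl, rfl⟩
    obtain ⟨p, φ, hdeep⟩ := exists_isDeepest h1 hk hl hkl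
    obtain ⟨hs, he⟩ := hdeep.slope h1 hk hl hkl
    refine ⟨k, l, hk, hl, hkl, p, φ, hdeep, x / Real.sin φ, by positivity, ?_, ?_⟩
    · rw [← he]
      ext
      · simp only; field_simp
      · simp only; field_simp
    · exact aux k l hk hl hkl x hx

/-! ### Empty cones with apex in the box -/

theorem convex_cone (i : ℕ) (p : Plane) (φ : ℝ) : Convex ℝ (cone (theta i) p φ) := by
  intro q hq r hr a b ha hb hab
  rw [mem_cone_iff, abs_lt] at *
  obtain ⟨hq1, hq2⟩ := hq
  obtain ⟨hr1, hr2⟩ := hr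
  obtain rfl : b = 1 - a := by linarith
  simp only [Prod.fst_add, Prod.snd_add, Prod.smul_fst, Prod.smul_snd, smul_eq_mul]
  rcases ha.eq_or_lt with rfl | ha
  · constructor <;> nlinarith
  · have x1 := mul_lt_mul_of_pos_left hq1 ha
    have x2 := mul_lt_mul_of_pos_left hq2 ha
    have x3 := mul_le_mul_of_nonneg_left hr1.le hb
    have x4 := mul_le_mul_of_nonneg_left hr2.le hb
    constructor <;> nlinarith

theorem isOpen_cone (i : ℕ) (p : Plane) (φ : ℝ) : IsOpen (cone (theta i) p φ) := by
  have : cone (theta i) p φ = {q : Plane |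
      |(q.2 - p.2) * Real.cos φ - (q.1 - p.1) * Real.sin φ| <
        halfTan i * ((q.1 - p.1) * Real.cos φ + (q.2 - p.2) * Real.sin φ)} :=
    Set.ext fun q => mem_cone_iff i p q φ
  rw [this]
  exact isOpen_lt (by fun_prop) (by fun_prop)

theorem cone_subset_cone {i : ℕ} {p q : Plane} {φ : ℝ} (hq : q ∈ cone (theta i) p φ) :
    cone (theta i) q φ ⊆ cone (theta i) p φ := by
  intro r hr
  rw [mem_cone_iff, abs_lt] at *
  constructor <;> linarith [hq.1, hq.2, hr.1, hr.2]

/-- A horizontal section of a convex set is an interval, so it cannot leave `[a, b]` without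
containing an end point. -/
theorem passesBetween_of_notMem {C : Set Plane} (hC : Convex ℝ C) {a b z y : ℝ}
    (hz : (z, y) ∈ C) (ha : a < z) (hb : z < b) (ha' : (a, y) ∉ C) (hb' : (b, y) ∉ C) :
    PassesBetween C a b y := by
  refine ⟨⟨_, hz, rfl⟩, ?_⟩
  rintro ⟨w, y'⟩ hw rfl
  have key : ∀ c, (w ≤ c ∧ c ≤ z ∨ z ≤ c ∧ c ≤ w) → (c, y') ∈ C := by
    intro c hc
    have : c ∈ segment ℝ w z := by rw [segment_eq_uIcc, Set.mem_uIcc]; exact hc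
    obtain ⟨s, t, hs, ht, hst, rfl⟩ := this
    have := hC hw hz hs ht hst
    have e : ((s • w + t • z, y') : Plane) = s • (w, y') + t • (z, y') := by
      ext
      · simp
      · simp only [Prod.snd_add, Prod.smul_snd, smul_eq_mul]
        rw [← add_mul, hst, one_mul]
    rw [e]; exact this
  simp only
  constructor
  · by_contra h
    push Not at h
    exact ha' (key a (Or.inl ⟨h.le, ha.le⟩))
  · by_contra h
    push Not at h
    exact hb' (key b (Or.inr ⟨hb.le, h.le⟩))

theorem mem_guards_of_mem_firstUpper {i : ℕ} {x : ℝ} {q : Plane} (h : q ∈ firstUpper i) :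
    q ∈ guards i x := Or.inl (mem_fourfold.2 (Or.inl h))

theorem mem_patternA_firstUpper {i : ℕ} {m : ℤ} (hm : -(i : ℤ) ≤ m ∧ m < i) {q : Plane}
    (hq : q ∈ patternA i m) : q ∈ firstUpper i := Or.inl ⟨m, hm.1, hm.2, hq⟩

theorem int_mem_firstUpper {i : ℕ} {m : ℤ} (h1 : -(4 * (i : ℤ)) ≤ m) (h2 : m < 4 * i) :
    (((m : ℝ), 4 * (i : ℝ)) : Plane) ∈ firstUpper i ∧
      (((m : ℝ) + 1, 4 * (i : ℝ)) : Plane) ∈ firstUpper i := by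
  by_cases h : -(i : ℤ) ≤ m ∧ m < i
  · exact ⟨mem_patternA_firstUpper h (by simp [patternA]),
      mem_patternA_firstUpper h (by simp [patternA])⟩
  · exact ⟨Or.inr ⟨m, h1, h2, h, by simp [patternB]⟩, Or.inr ⟨m, h1, h2, h, by simp [patternB]⟩⟩

/-- The intermediate value theorem for the maximum norm along the axis finds the crossing with the
boundary of `box (4i)`; the side that is hit determines the rotation. -/
theorem exists_rot_axis_hits_top {i : ℕ} (h1 : 1 ≤ i) {q : Plane} (hq : q ∈ box i) (φ : ℝ) :
    ∃ s ∈ Finset.range 4, ∃ r : ℝ, 0 < r ∧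
      (rot^[s] q).2 + r * Real.sin (φ + s * (Real.pi / 2)) = 4 * i ∧
      |(rot^[s] q).1 + r * Real.cos (φ + s * (Real.pi / 2))| ≤ 4 * i := by
  have hi0 : (0 : ℝ) < i := by exact_mod_cast h1
  set f : ℝ → ℝ := fun r => max |q.1 + r * Real.cos φ| |q.2 + r * Real.sin φ| with hf
  have hcont : Continuous f := by fun_prop
  have hf0 : f 0 ≤ i := by
    simp only [hf, zero_mul, add_zero]; exact max_le hq.1 hq.2
  -- One of `cos φ`, `sin φ` is at least 1/2 in absolute value, so that coordinate moves by at least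
  -- `10i` and ends at `9i` or more.
  have hf1 : 4 * (i : ℝ) ≤ f (20 * i) := by
    have hsc := Real.sin_sq_add_cos_sq φ
    have hor : 1 / 2 ≤ |Real.cos φ| ∨ 1 / 2 ≤ |Real.sin φ| := by
      by_contra h
      push Not at h
      have a := sq_abs (Real.cos φ)
      have b := sq_abs (Real.sin φ)
      nlinarith [abs_nonneg (Real.cos φ), abs_nonneg (Real.sin φ)]
    have aux : ∀ y c : ℝ, |y| ≤ i → 1 / 2 ≤ |c| → 4 * (i : ℝ) ≤ |y + 20 * i * c| := by
      intro y c hy hc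
      have e := abs_sub_abs_le_abs_sub (20 * i * c) (-y)
      rw [abs_mul, abs_neg, abs_of_pos (show (0 : ℝ) < 20 * i by linarith),
        show 20 * i * c - -y = y + 20 * i * c by ring] at e
      nlinarith
    rcases hor with h | h
    · exact (aux _ _ hq.1 h).trans (le_max_left _ _)
    · exact (aux _ _ hq.2 h).trans (le_max_right _ _)
  obtain ⟨r, hr, hfr⟩ := intermediate_value_Icc (show (0 : ℝ) ≤ 20 * i by linarith)
    hcont.continuousOn ⟨show f 0 ≤ 4 * (i : ℝ) by linarith, hf1⟩
  have hr0 : 0 < r := by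
    rcases hr.1.eq_or_lt with h | h
    · rw [← h] at hfr; linarith
    · exact h
  have hx : |q.1 + r * Real.cos φ| ≤ 4 * i := (le_max_left _ _).trans_eq hfr
  have hy : |q.2 + r * Real.sin φ| ≤ 4 * i := (le_max_right _ _).trans_eq hfr
  have e2 : φ + ((2 : ℕ) : ℝ) * (Real.pi / 2) = φ + Real.pi := by push_cast; ring
  have e3 : φ + ((3 : ℕ) : ℝ) * (Real.pi / 2) = φ + Real.pi + Real.pi / 2 := by push_cast; ring
  rcases max_choice |q.1 + r * Real.cos φ| |q.2 + r * Real.sin φ| with h | h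
  · have : |q.1 + r * Real.cos φ| = 4 * i := by rw [← h]; exact hfr
    rcases (abs_eq (by positivity)).1 this with h' | h'
    · refine ⟨1, by simp, r, hr0, ?_, ?_⟩
      · simp [rot, Real.sin_add_pi_div_two, h']
      · simp only [Function.iterate_one, rot, Nat.cast_one, one_mul, Real.cos_add_pi_div_two]
        rw [show -q.2 + r * -Real.sin φ = -(q.2 + r * Real.sin φ) by ring, abs_neg]
        exact hy
    · refine ⟨3, by simp, r, hr0, ?_, ?_⟩
      · rw [e3, Real.sin_add_pi_div_two, Real.cos_add_pi]
        simp [rot]; linarith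
      · rw [e3, Real.cos_add_pi_div_two, Real.sin_add_pi]
        simpa [rot] using hy
  · have : |q.2 + r * Real.sin φ| = 4 * i := by rw [← h]; exact hfr
    rcases (abs_eq (by positivity)).1 this with h' | h'
    · exact ⟨0, by simp, r, hr0, by simpa using h', by simpa using hx⟩
    · refine ⟨2, by simp, r, hr0, ?_, ?_⟩
      · rw [e2, Real.sin_add_pi]
        simp [rot]; linarith
      · rw [e2, Real.cos_add_pi, ← abs_neg]
        simp only [Function.iterate_succ, Function.iterate_zero, Function.comp, id, rot]
        convert hx using 2
        ring

/-- An apex in `box i` turns `Threads.le_hi` and `Threads.lo_le` into `2i * hi ≥ d + 3/4 * v ^ 2`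
and `2i * lo ≤ d - 3/4 * v ^ 2` with `d = a - b`, whereas the deepest axis satisfies `2i * V = d - V
* r / 4`. So `V` is separated from both ray slopes by a fixed `ε`, and over the height `x` this
outweighs the offset of the apex from the origin. -/
theorem Threads.far_bounds_of_pos {i : ℕ} (h1 : 1 ≤ i) {a b : ℝ} {q : Plane} {v x : ℝ}
    (h : Threads i a b q v) (hd : 1 ≤ a - b) (hd' : a - b ≤ 2 * i - 1) (hq : q ∈ box i)
    (hx : 2000 * (i : ℝ) ^ 4 ≤ x) :
    lo i v * (x - q.2) < axisSlope i (a - b) * x - q.1 ∧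
      axisSlope i (a - b) * x - q.1 < hi i v * (x - q.2) := by
  have hi1 : (1 : ℝ) ≤ i := by exact_mod_cast h1
  have ht := halfTan_pos h1
  have e2 := halfTan_mul h1
  have hu := h.1
  have hV := axisSlope_pos h1 hd
  have hV1 := axisSlope_le h1 hd hd'
  have hV2 := le_axisSlope h1 hd hd'
  have hr := raySlope_le_mul_axisSlope h1 hd hd'
  have hr0 := raySlope_pos h1 hd
  have eV := two_mul_axisSlope_mul h1 hd
  have eax := axisSlope_mul h1 hd
  have hw := le_hi_sub_lo h1 hu
  have hlov := lo_lt_self h1 hu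
  have b1 := h.le_hi
  have b2 := h.lo_le
  obtain ⟨hq1, hq2⟩ := hq
  obtain ⟨q1l, q1r⟩ := abs_le.1 hq1
  obtain ⟨q2l, q2r⟩ := abs_le.1 hq2
  have hi4 : (i : ℝ) ≤ i ^ 4 := by
    calc (i : ℝ) = i ^ 1 := (pow_one _).symm
      _ ≤ i ^ 4 := pow_le_pow_right₀ hi1 (by norm_num)
  -- The apex is at least `3i` below the top row, and `2 * halfTan i * 3i = 3 / 4`.
  have hwh : 3 / 4 * (1 + v ^ 2) ≤ (hi i v - lo i v) * (4 * i - q.2) := by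
    have h3 : (2 * halfTan i * (1 + v ^ 2)) * (3 * i) ≤ (hi i v - lo i v) * (4 * i - q.2) :=
      mul_le_mul hw (by linarith) (by linarith)
        (le_trans (by positivity) hw)
    have : (2 * halfTan i * (1 + v ^ 2)) * (3 * i) = 3 / 4 * (1 + v ^ 2) := by
      linear_combination 6 * (1 + v ^ 2) * e2
    linarith
  set V := axisSlope i (a - b)
  set r := raySlope i (a - b)
  set t := halfTan i
  have eV' : 2 * i * V + V * r / 4 = a - b := by
    linear_combination eV - 2 * V * r * e2
  have hVr : V ≤ r := by linarith [mul_pos hV (mul_pos hr0 ht)]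
  have hVr1 : V * V ≤ V * r := mul_le_mul_of_nonneg_left hVr hV.le
  have hVr2 : V * (32 * r) ≤ V * (45 * V) := mul_le_mul_of_nonneg_left hr hV.le
  obtain ⟨ε, hε⟩ : ∃ ε : ℝ, 100 * i * ε = V ^ 2 := ⟨V ^ 2 / (100 * i), by field_simp⟩
  have hε0 : 0 < ε := by
    have : 0 < 100 * i * ε := by rw [hε]; positivity
    exact pos_of_mul_pos_right this (by linarith)
  have hεV : ε ≤ V / 100 := by
    linarith [mul_le_mul_of_nonneg_right hi1 hε0.le,
      mul_le_mul_of_nonneg_left (show V ≤ 1 by linarith) hV.le]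
  -- From `V ≥ 4 / (9i)` one gets `ε ≥ 16 / (8100 i ^ 3)`, so `2000 * i ^ 4` suffices; `3i` covers
  -- the horizontal and vertical offsets of the apex.
  have hεx : 3 * (i : ℝ) < ε * x := by
    have h5 : 16 ≤ 81 * (i : ℝ) ^ 2 * V ^ 2 := by
      linarith [mul_le_mul hV2 hV2 (by norm_num) (by linarith)]
    rw [← hε] at h5
    have h6 : ε * (2000 * (i : ℝ) ^ 4) ≤ ε * x := mul_le_mul_of_nonneg_left hx hε0.le
    have h7 : 16 * (i : ℝ) ≤ 81 * (i : ℝ) ^ 2 * (100 * i * ε) * i :=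
      mul_le_mul_of_nonneg_right h5 (by linarith)
    linarith
  have hright : V + ε ≤ hi i v := by
    have : 2 * i * (V + ε) ≤ 2 * i * hi i v := by linarith [sq_nonneg v]
    exact le_of_mul_le_mul_left this (by linarith)
  -- Otherwise `v > lo i v` is nearly `V` or larger, and `3/4 * v ^ 2` exceeds `V * r / 4`, which is
  -- at most `45/128 * V ^ 2`, by too much.
  have hleft : lo i v ≤ V - ε := by
    by_contra hneg
    push Not at hneg
    have hv1 : 99 / 100 * V ≤ v := by linarith
    have hv2 : 98 / 100 * V ^ 2 ≤ v ^ 2 := by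
      have := pow_le_pow_left₀ (by positivity) hv1 2
      linarith [sq_nonneg V]
    have hm : 2 * i * (V - ε) < 2 * i * lo i v := mul_lt_mul_of_pos_left hneg (by linarith)
    linarith [sq_nonneg V, show 0 < V ^ 2 by positivity]
  have hxi : (i : ℝ) ≤ x := by linarith
  constructor
  · have := mul_le_mul_of_nonneg_right hleft (show 0 ≤ x - q.2 by linarith)
    have h8 : (V - ε) * q.2 ≥ -i := by
      have : |(V - ε) * q.2| ≤ 1 * i := by
        rw [abs_mul]
        exact mul_le_mul (abs_le.2 ⟨by linarith, by linarith⟩) hq2 (abs_nonneg _) zero_le_one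
      linarith [(abs_le.1 this).1]
    linarith
  · have := mul_le_mul_of_nonneg_right hright (show 0 ≤ x - q.2 by linarith)
    have h8 : (V + ε) * q.2 ≤ 2 * i := by
      have : |(V + ε) * q.2| ≤ 2 * i := by
        rw [abs_mul]
        exact mul_le_mul (abs_le.2 ⟨by linarith, by linarith⟩) hq2 (abs_nonneg _) zero_le_two
      exact (abs_le.1 this).2
    linarith

theorem Threads.far_bounds {i : ℕ} (h1 : 1 ≤ i) {k l : ℤ} (hk : -(i : ℤ) ≤ k ∧ k < i)
    (hl : -(i : ℤ) ≤ l ∧ l < i) (hkl : k ≠ l) {q : Plane} {v x : ℝ}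
    (h : Threads i k l q v) (hq : q ∈ box i) (hx : 2000 * (i : ℝ) ^ 4 ≤ x) :
    lo i v * (x - q.2) < deepSlope i (k - l) * x - q.1 ∧
      deepSlope i (k - l) * x - q.1 < hi i v * (x - q.2) := by
  have k1 : -(i : ℝ) ≤ k := by exact_mod_cast hk.1
  have k2 : (k : ℝ) + 1 ≤ i := by exact_mod_cast hk.2
  have l1 : -(i : ℝ) ≤ l := by exact_mod_cast hl.1
  have l2 : (l : ℝ) + 1 ≤ i := by exact_mod_cast hl.2
  rcases lt_or_gt_of_ne hkl with hlt | hlt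
  · have h' : (k : ℝ) + 1 ≤ l := by exact_mod_cast hlt
    have e : ((-(k : ℝ) - 1) - (-(l : ℝ) - 1)) = -(k - l) := by ring
    rw [deepSlope_of_neg (show (k : ℝ) - l < 0 by linarith)]
    have := h.mirror.far_bounds_of_pos h1 (by linarith) (by linarith)
      (show (-q.1, q.2) ∈ box i from ⟨by simpa using hq.1, hq.2⟩) hx
    rw [e, lo_neg, hi_neg] at this
    simp only at this
    constructor <;> linarith [this.1, this.2]
  · have h' : (l : ℝ) + 1 ≤ k := by exact_mod_cast hlt
    rw [deepSlope_of_pos (show 0 < (k : ℝ) - l by linarith)]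
    exact h.far_bounds_of_pos h1 (by linarith) (by linarith) hq hx

/-- A cone with apex at height at most `i` that crosses height `2i` within a gap of length `1/4`
is vertical, with its apex exactly at height `i`. -/
theorem narrow_gap_bounds {i : ℕ} (h1 : 1 ≤ i) {q : Plane} {v k c : ℝ} (hu : Upward i v)
    (hq : q.2 ≤ i) (p1 : k ≤ q.1 + lo i v * (4 * i - q.2))
    (p2 : q.1 + hi i v * (4 * i - q.2) ≤ k + 1) (c1 : c ≤ q.1 + lo i v * (2 * i - q.2))
    (c2 : q.1 + hi i v * (2 * i - q.2) ≤ c + 1 / 4) : k ≤ c - 1 / 4 ∧ c + 1 / 2 ≤ k + 1 := by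
  have hi1 : (1 : ℝ) ≤ i := by exact_mod_cast h1
  have hw := le_hi_sub_lo h1 hu
  have e2 := halfTan_mul h1
  have d1 : 2 * halfTan i * (1 + v ^ 2) * (2 * i - q.2) ≤ 1 / 4 := by
    have := mul_le_mul_of_nonneg_right hw (show 0 ≤ 2 * i - q.2 by linarith)
    linarith
  have d2 : (1 + v ^ 2) * (2 * i - q.2) ≤ i := by
    have : 4 * i * (2 * halfTan i * (1 + v ^ 2) * (2 * i - q.2))
        = (1 + v ^ 2) * (2 * i - q.2) := by
      linear_combination 8 * (1 + v ^ 2) * (2 * i - q.2) * e2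
    nlinarith
  have d3 := mul_le_mul_of_nonneg_left (show (i : ℝ) ≤ 2 * i - q.2 by linarith)
    (show 0 ≤ 1 + v ^ 2 by positivity)
  have hv0 : v = 0 := by
    have : v ^ 2 * i ≤ 0 := by linarith
    have : v ^ 2 ≤ 0 := by
      by_contra hh
      push Not at hh
      nlinarith
    exact pow_eq_zero_iff (two_ne_zero) |>.1 (le_antisymm this (sq_nonneg v))
  have hqi : q.2 = i := by rw [hv0] at d2; linarith
  have elo : lo i v = -halfTan i := by rw [hv0]; unfold lo; simp
  have ehi : hi i v = halfTan i := by rw [hv0]; unfold hi; simp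
  rw [elo, hqi] at c1 p1
  rw [ehi, hqi] at c2 p2
  constructor <;> linarith

theorem passesThrough_of_isEmptyOf {i : ℕ} (h1 : 1 ≤ i) {x : ℝ} (hx : 2000 * (i : ℝ) ^ 4 ≤ x)
    {q : Plane} {φ r : ℝ} (hq : q ∈ box i) (hr : 0 < r) (htop : q.2 + r * Real.sin φ = 4 * i)
    (hside : |q.1 + r * Real.cos φ| ≤ 4 * i)
    (hemp : IsEmptyOf (cone (theta i) q φ) (guards i x)) :
    ∃ k : ℤ, (-(i : ℤ) ≤ k ∧ k < i) ∧ PassesThrough i k k q φ := by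
  have hi1 : (1 : ℝ) ≤ i := by exact_mod_cast h1
  have ht := halfTan_pos h1
  have e2 := halfTan_mul h1
  obtain ⟨hq1, hq2⟩ := hq
  obtain ⟨q1l, q1r⟩ := abs_le.1 hq1
  obtain ⟨q2l, q2r⟩ := abs_le.1 hq2
  have hs : 0 < Real.sin φ := by
    have : 0 < r * Real.sin φ := by linarith
    exact pos_of_mul_pos_right this hr.le
  have hnot : ∀ g ∈ firstUpper i, g ∉ cone (theta i) q φ := by
    intro g hg hc
    have : g ∈ cone (theta i) q φ ∩ guards i x := ⟨hc, mem_guards_of_mem_firstUpper hg⟩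
    rw [hemp] at this
    exact this
  have haxis : ∀ r' : ℝ, 0 < r' →
      (q.1 + r' * Real.cos φ, q.2 + r' * Real.sin φ) ∈ cone (theta i) q φ := by
    intro r' hr'
    rw [mem_cone_iff]
    simp only [add_sub_cancel_left]
    have hsc := Real.sin_sq_add_cos_sq φ
    have : r' * Real.cos φ * Real.cos φ + r' * Real.sin φ * Real.sin φ = r' := by
      linear_combination r' * hsc
    rw [this]
    ring_nf
    rw [abs_zero]
    positivity
  have hconv := convex_cone i q φ
  obtain ⟨a, ha⟩ : ∃ a, a = q.1 + r * Real.cos φ := ⟨_, rfl⟩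
  have hA : (a, 4 * (i : ℝ)) ∈ cone (theta i) q φ := by rw [ha, ← htop]; exact haxis r hr
  rw [← ha] at hside
  obtain ⟨hal, har⟩ := abs_le.1 hside
  -- the gap of the top row
  obtain ⟨k, hkdef⟩ : ∃ k, k = ⌊a⌋ := ⟨_, rfl⟩
  have hka : (k : ℝ) ≤ a := by rw [hkdef]; exact Int.floor_le a
  have hak : a < k + 1 := by rw [hkdef]; exact Int.lt_floor_add_one a
  have hk4 : -(4 * (i : ℤ)) ≤ k := by
    rw [hkdef, Int.le_floor]; push_cast; linarith
  have hk4' : k < 4 * i := by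
    have hle : k ≤ 4 * i := by
      have : (k : ℝ) ≤ 4 * i := by linarith
      exact_mod_cast this
    rcases hle.lt_or_eq with h | h
    · exact h
    -- The value `a = 4i` is the right-hand guard of the last cell.
    · exfalso
      have hcast : (k : ℝ) = 4 * i := by rw [h]; push_cast; rfl
      have : a = ((4 * (i : ℤ) - 1 : ℤ) : ℝ) + 1 := by push_cast; linarith
      rw [this] at hA
      exact hnot _ (int_mem_firstUpper (by omega) (by omega)).2 hA
  obtain ⟨g1, g2⟩ := int_mem_firstUpper hk4 hk4'
  have hka' : (k : ℝ) < a := by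
    rcases hka.lt_or_eq with h | h
    · exact h
    · rw [← h] at hA; exact absurd hA (hnot _ g1)
  have hP : PassesBetween (cone (theta i) q φ) k (k + 1) (4 * i) :=
    passesBetween_of_notMem hconv hA hka' hak (hnot _ g1) (hnot _ g2)
  obtain ⟨-, hu⟩ := upward_of_passesBetween h1 (by linarith) hP
  obtain ⟨v, hv⟩ : ∃ v, v = Real.cos φ / Real.sin φ := ⟨_, rfl⟩
  have hw := le_hi_sub_lo h1 hu
  have hcv : Real.cos φ = v * Real.sin φ := by rw [hv]; field_simp
  have hwidth : ∀ a b y : ℝ, q.2 < y → PassesBetween (cone (theta i) q φ) a b y →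
      a ≤ q.1 + lo i v * (y - q.2) ∧ q.1 + hi i v * (y - q.2) ≤ b := by
    intro a b y hy h
    rw [hv]
    exact (passesBetween_iff_slope h1 hy hs hu).1 h
  rw [← hv] at hw hu
  -- In pattern B the gaps have length 1/2, but the cone is at least 3/4 wide here.
  have hkA : -(i : ℤ) ≤ k ∧ k < i := by
    by_contra hcon
    have g3 : (((k : ℝ) + 1 / 2, 4 * (i : ℝ)) : Plane) ∈ firstUpper i :=
      Or.inr ⟨k, hk4, hk4', hcon, by simp [patternB]⟩
    have hw' : 3 / 4 ≤ (hi i v - lo i v) * (4 * i - q.2) := by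
      have : 2 * halfTan i * (3 * i) ≤ (hi i v - lo i v) * (4 * i - q.2) :=
        mul_le_mul (by nlinarith [sq_nonneg v]) (by linarith) (by linarith)
          (le_trans (by positivity) hw)
      linarith
    rcases lt_trichotomy a (k + 1 / 2) with h | h | h
    · obtain ⟨w1, w2⟩ := hwidth _ _ _ (by linarith)
        (passesBetween_of_notMem hconv hA hka' h (hnot _ g1) (hnot _ g3))
      linarith
    · rw [h] at hA; exact hnot _ g3 hA
    · obtain ⟨w1, w2⟩ := hwidth _ _ _ (by linarith)
        (passesBetween_of_notMem hconv hA h hak (hnot _ g3) (hnot _ g2))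
      linarith
  have k1 : -(i : ℝ) ≤ k := by exact_mod_cast hkA.1
  have k2 : (k : ℝ) + 1 ≤ i := by exact_mod_cast hkA.2
  -- the gap of the middle row
  obtain ⟨b, hb⟩ : ∃ b, b = q.1 + v * (2 * i - q.2) := ⟨_, rfl⟩
  have hav : a = q.1 + v * (4 * i - q.2) := by
    rw [ha, hcv]; linear_combination v * htop
  have hB : (b, 2 * (i : ℝ)) ∈ cone (theta i) q φ := by
    have := haxis ((2 * i - q.2) / Real.sin φ) (div_pos (by linarith) hs)
    convert this using 2
    · rw [hb, hcv]; field_simp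
    · field_simp; ring
  -- The crossing `b` is a weighted mean of `q.1` and `a`, so it too lies over a cell with pattern
  -- A.
  have hbi : (4 * i - q.2) * b = q.1 * (2 * i) + a * (2 * i - q.2) := by rw [hb, hav]; ring
  have hb1 : -(i : ℝ) ≤ b := by
    have : (4 * i - q.2) * (-i) ≤ (4 * i - q.2) * b := by rw [hbi]; nlinarith
    exact le_of_mul_le_mul_left this (by linarith)
  have hb2 : b < i := by
    have : (4 * i - q.2) * b < (4 * i - q.2) * i := by rw [hbi]; nlinarith
    exact lt_of_mul_lt_mul_left this (by linarith)
  obtain ⟨l, hldef⟩ : ∃ l, l = ⌊b⌋ := ⟨_, rfl⟩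
  have hlb : (l : ℝ) ≤ b := by rw [hldef]; exact Int.floor_le b
  have hbl : b < l + 1 := by rw [hldef]; exact Int.lt_floor_add_one b
  have hl : -(i : ℤ) ≤ l ∧ l < i := by
    constructor
    · rw [hldef, Int.le_floor]; push_cast; exact hb1
    · have : (l : ℝ) < i := by linarith
      exact_mod_cast this
  have gA : ∀ {z : ℝ}, ((z, 2 * (i : ℝ)) : Plane) ∈ patternA i l →
      ((z, 2 * (i : ℝ)) : Plane) ∉ cone (theta i) q φ :=
    fun h => hnot _ (mem_patternA_firstUpper hl h)
  have n1 := gA (z := l) (by simp [patternA])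
  have n2 := gA (z := l + 1 / 4) (by simp [patternA])
  have n3 := gA (z := l + 3 / 4) (by simp [patternA])
  have n4 := gA (z := l + 1) (by simp [patternA])
  obtain ⟨p1, p2⟩ := hwidth _ _ _ (by linarith) hP
  have hnarrow : ∀ c : ℝ, c ≤ q.1 + lo i v * (2 * i - q.2) →
      q.1 + hi i v * (2 * i - q.2) ≤ c + 1 / 4 →
      (k : ℝ) ≤ c - 1 / 4 ∧ c + 1 / 2 ≤ k + 1 :=
    fun c c1 c2 => narrow_gap_bounds h1 hu q2r p1 p2 c1 c2
  -- Either outer gap of the cell has length 1/4; the resulting section at height `4i` would contain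
  -- an integer in its interior and so cannot fit into `[k, k + 1]`.
  have hQ : PassesBetween (cone (theta i) q φ) (l + 1 / 4) (l + 3 / 4) (2 * i) := by
    rcases hlb.eq_or_lt with h | hlb'
    · rw [← h] at hB; exact absurd hB n1
    rcases lt_trichotomy b (l + 1 / 4) with h | h | h
    · exfalso
      obtain ⟨w1, w2⟩ := hwidth _ _ _ (by linarith) (passesBetween_of_notMem hconv hB hlb' h n1 n2)
      obtain ⟨z1, z2⟩ := hnarrow l w1 w2
      have c1 : k < l := by
        have : (k : ℝ) < l := by linarith
        exact_mod_cast this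
      have c2 : l < k + 1 := by
        have : (l : ℝ) < k + 1 := by linarith
        exact_mod_cast this
      omega
    · rw [h] at hB; exact absurd hB n2
    rcases lt_trichotomy b (l + 3 / 4) with h' | h' | h'
    · exact passesBetween_of_notMem hconv hB h h' n2 n3
    · rw [h'] at hB; exact absurd hB n3
    · exfalso
      obtain ⟨w1, w2⟩ := hwidth _ _ _ (by linarith) (passesBetween_of_notMem hconv hB h' hbl n3 n4)
      obtain ⟨z1, z2⟩ := hnarrow (l + 3 / 4) w1 (by linarith)
      have c1 : k < l + 1 := by
        have : (k : ℝ) < l + 1 := by linarith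
        exact_mod_cast this
      have c2 : l < k := by
        have : (l : ℝ) < k := by linarith
        exact_mod_cast this
      omega
  have hpass : PassesThrough i k l q φ := ⟨by linarith, hP, hQ⟩
  by_cases hkl : k = l
  · exact ⟨k, hkA, by rw [← hkl] at hpass; exact hpass⟩
  · exfalso
    obtain ⟨-, hT⟩ := (passesThrough_iff h1).1 hpass
    have hfar := hT.far_bounds h1 hkA hl hkl ⟨hq1, hq2⟩ hx
    have hx0 : 0 < x := lt_of_lt_of_le (by positivity) hx
    have hmem : (deepSlope i (k - l) * x, x) ∈ cone (theta i) q φ :=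
      (mem_cone_iff_slope hs hT.1).2 hfar
    have hg : (deepSlope i (k - l) * x, x) ∈ guards i x :=
      Or.inr (mem_fourfold.2 (Or.inl ((mem_secondUpper_iff h1 hx0).2 ⟨k, l, hkA, hl, hkl, rfl⟩)))
    have : (deepSlope i (k - l) * x, x) ∈ cone (theta i) q φ ∩ guards i x := ⟨hmem, hg⟩
    rw [hemp] at this
    exact this

theorem isWantedCone_of_mem_box {i : ℕ} (h1 : 1 ≤ i) {x : ℝ}
    (hx : 2000 * (i : ℝ) ^ 4 ≤ x) {q : Plane} {φ : ℝ} (hq : q ∈ box i)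
    (hemp : IsEmptyOf (cone (theta i) q φ) (guards i x)) : IsWantedCone i q φ := by
  obtain ⟨s, hs, r, hr, htop, hside⟩ := exists_rot_axis_hits_top h1 hq φ
  obtain ⟨k, hk, h⟩ := passesThrough_of_isEmptyOf h1 hx ((rot_iterate_mem_box s).2 hq) hr htop hside
    ((isEmptyOf_rot_iterate (fun _ => rot_mem_guards) s).2 hemp)
  exact ⟨s, hs, k, hk, h⟩

theorem rot_iterate_mem_cone {i : ℕ} {p q : Plane} {φ : ℝ} (s : ℕ) :
    rot^[s] q ∈ cone (theta i) (rot^[s] p) (φ + s * (Real.pi / 2)) ↔ q ∈ cone (theta i) p φ := by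
  induction s with
  | zero => simp
  | succ s ih =>
    have e : φ + ((s + 1 : ℕ) : ℝ) * (Real.pi / 2) = φ + s * (Real.pi / 2) + Real.pi / 2 := by
      push_cast; ring
    rw [Function.iterate_succ_apply', Function.iterate_succ_apply', e, rot_mem_cone, ih]

/-- Translating the cone to one of its points in the box gives an empty subcone, which is wanted.
The full cone is convex, contains the subcone and avoids the ends of the gaps, so it passes through
the same gaps. -/
theorem isWantedCone_of_isEmptyOf {i : ℕ} (h1 : 1 ≤ i) {x : ℝ} (hx : 2000 * (i : ℝ) ^ 4 ≤ x)
    {p : Plane} {φ : ℝ} (hemp : IsEmptyOf (cone (theta i) p φ) (guards i x))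
    (hne : (cone (theta i) p φ ∩ box i).Nonempty) : IsWantedCone i p φ := by
  obtain ⟨q, hq, hqb⟩ := hne
  have hemp' : IsEmptyOf (cone (theta i) q φ) (guards i x) :=
    Set.eq_empty_of_subset_empty fun g hg =>
      hemp ▸ (⟨cone_subset_cone hq hg.1, hg.2⟩ : g ∈ cone (theta i) p φ ∩ guards i x)
  obtain ⟨s, hs, k, hk, hpass⟩ := isWantedCone_of_mem_box h1 hx hqb hemp'
  refine ⟨s, hs, k, hk, ?_⟩
  have hqs := (rot_iterate_mem_cone s).2 hq
  have hes := (isEmptyOf_rot_iterate (G := guards i x) (fun _ => rot_mem_guards) s).2 hemp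
  have hbs := (rot_iterate_mem_box s).2 hqb
  revert hqs hes hbs hpass
  generalize rot^[s] q = q'
  generalize rot^[s] p = p'
  generalize φ + s * (Real.pi / 2) = ψ
  intro hpass hqs hes hbs
  have hi1 : (1 : ℝ) ≤ i := by exact_mod_cast h1
  obtain ⟨hsin, hu, hq2, a1, a2, a3, a4⟩ := (passesThrough_iff h1).1 hpass
  have hlt := hi_sub_lo_pos h1 hu
  obtain ⟨c1, c2⟩ := (mem_cone_iff_slope hsin hu).1 hqs
  have hp2 : p'.2 < q'.2 := by
    by_contra hneg
    push Not at hneg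
    nlinarith
  have hnot : ∀ g ∈ firstUpper i, g ∉ cone (theta i) p' ψ := by
    intro g hg hc
    have : g ∈ cone (theta i) p' ψ ∩ guards i x := ⟨hc, mem_guards_of_mem_firstUpper hg⟩
    rw [hes] at this
    exact this
  have hsub := cone_subset_cone hqs
  have hmid : ∀ y, q'.2 < y → (q'.1 + (lo i (Real.cos ψ / Real.sin ψ) * (y - q'.2) +
      hi i (Real.cos ψ / Real.sin ψ) * (y - q'.2)) / 2, y) ∈ cone (theta i) q' ψ := by
    intro y hy
    have := mul_lt_mul_of_pos_right hlt (show 0 < y - q'.2 by linarith)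
    exact (mem_cone_iff_slope hsin hu).2 ⟨by simp only; linarith, by simp only; linarith⟩
  have hl1 := mul_lt_mul_of_pos_right hlt (show 0 < 4 * i - q'.2 by linarith)
  have hl2 := mul_lt_mul_of_pos_right hlt (show 0 < 2 * i - q'.2 by linarith)
  refine ⟨by linarith, ?_, ?_⟩
  · refine passesBetween_of_notMem (convex_cone i p' ψ) (hsub (hmid _ (by linarith)))
      (by linarith) (by linarith) (hnot _ (mem_patternA_firstUpper hk (by simp [patternA])))
      (hnot _ (mem_patternA_firstUpper hk (by simp [patternA])))
  · refine passesBetween_of_notMem (convex_cone i p' ψ) (hsub (hmid _ (by linarith)))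
      (by linarith) (by linarith) (hnot _ (mem_patternA_firstUpper hk (by simp [patternA])))
      (hnot _ (mem_patternA_firstUpper hk (by simp [patternA])))

/-! ### The spikes formed by the wanted cones -/

theorem le_abs_deepSlope {i : ℕ} (h1 : 1 ≤ i) {k l : ℤ} (hk : -(i : ℤ) ≤ k ∧ k < i)
    (hl : -(i : ℤ) ≤ l ∧ l < i) (hkl : k ≠ l) : 4 ≤ 9 * i * |deepSlope i (k - l)| := by
  have k1 : -(i : ℝ) ≤ k := by exact_mod_cast hk.1
  have k2 : (k : ℝ) + 1 ≤ i := by exact_mod_cast hk.2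
  have l1 : -(i : ℝ) ≤ l := by exact_mod_cast hl.1
  have l2 : (l : ℝ) + 1 ≤ i := by exact_mod_cast hl.2
  rcases lt_or_gt_of_ne hkl with h | h
  · have h' : (k : ℝ) + 1 ≤ l := by exact_mod_cast h
    rw [deepSlope_of_neg (show (k : ℝ) - l < 0 by linarith), abs_neg,
      abs_of_pos (axisSlope_pos h1 (by linarith))]
    exact le_axisSlope h1 (by linarith) (by linarith)
  · have h' : (l : ℝ) + 1 ≤ k := by exact_mod_cast h
    rw [deepSlope_of_pos (show 0 < (k : ℝ) - l by linarith),
      abs_of_pos (axisSlope_pos h1 (by linarith))]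
    exact le_axisSlope h1 (by linarith) (by linarith)

/-- Here `Threads.le_hi` and `Threads.lo_le` have offset 0 and the width at the top is at least 3/4,
so the two rays lean to opposite sides of the vertical. Hence the apex lies over the gap of `Q`. -/
theorem Threads.self_bounds {i : ℕ} (h1 : 1 ≤ i) {a : ℝ} {q : Plane} {v : ℝ}
    (h : Threads i a a q v) (hq : q.2 ≤ i) :
    0 ≤ q.2 ∧ lo i v ≤ 0 ∧ 0 ≤ hi i v ∧ 3 * i * (hi i v - lo i v) ≤ 1 ∧
      a + 1 / 4 ≤ q.1 ∧ q.1 ≤ a + 3 / 4 := by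
  have hi1 : (1 : ℝ) ≤ i := by exact_mod_cast h1
  have ht := halfTan_pos h1
  have e2 := halfTan_mul h1
  have hw := le_hi_sub_lo h1 h.1
  have b0 := h.width_le_one
  have b1 := h.le_hi
  have b2 := h.lo_le
  obtain ⟨-, hq2, a1, a2, a3, a4⟩ := h
  have hw2 : 2 * halfTan i ≤ hi i v - lo i v :=
    le_trans (by nlinarith [sq_nonneg v]) hw
  have hw0 : 0 < hi i v - lo i v := by linarith
  have hq0 : 0 ≤ q.2 := by
    have : 2 * halfTan i * (4 * i - q.2) ≤ 1 :=
      (mul_le_mul_of_nonneg_right hw2 (by linarith)).trans b0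
    by_contra hneg
    push Not at hneg
    nlinarith
  have h3 : 3 * i * (hi i v - lo i v) ≤ (hi i v - lo i v) * (4 * i - q.2) := by
    rw [mul_comm]
    exact mul_le_mul_of_nonneg_left (by linarith) hw0.le
  have h34 : 3 / 4 ≤ 3 * i * (hi i v - lo i v) := by
    have := mul_le_mul_of_nonneg_left hw2 (show 0 ≤ 3 * (i : ℝ) by linarith)
    linarith
  have hlo : lo i v ≤ 0 := by
    by_contra hneg
    push Not at hneg
    nlinarith
  have hhi : 0 ≤ hi i v := by
    by_contra hneg
    push Not at hneg
    nlinarith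
  refine ⟨hq0, hlo, hhi, by linarith, ?_, ?_⟩
  · nlinarith [mul_nonneg_of_nonpos_of_nonpos hlo (show -(2 * i - q.2) ≤ 0 by linarith)]
  · nlinarith [mul_nonneg hhi (show 0 ≤ 2 * i - q.2 by linarith)]

/-- The rays have slope at most `1 / (3i)` in absolute value and the upper far guards at least `4 /
(9i)`; the large `x` absorbs the position of the apex. The far guards on the other three sides are
too flat or too low. -/
theorem PassesThrough.isEmptyOf_guards {i : ℕ} (h1 : 1 ≤ i) {x : ℝ} (hx : 2000 * (i : ℝ) ^ 4 ≤ x)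
    {k : ℤ} {q : Plane} {φ : ℝ} (h : PassesThrough i k k q φ) (hk : -(i : ℤ) ≤ k ∧ k < i)
    (hq : q ∈ box i) : IsEmptyOf (cone (theta i) q φ) (guards i x) := by
  have hi1 : (1 : ℝ) ≤ i := by exact_mod_cast h1
  have hi4 : (i : ℝ) * i ≤ i ^ 4 := by
    calc (i : ℝ) * i = i ^ 2 := (pow_two _).symm
      _ ≤ i ^ 4 := pow_le_pow_right₀ hi1 (by norm_num)
  have hx0 : 2000 * ((i : ℝ) * i) ≤ x := by linarith
  have hx1 : 2000 * (i : ℝ) ≤ x := by nlinarith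
  obtain ⟨hs, hT⟩ := (passesThrough_iff h1).1 h
  obtain ⟨hq1, hq2⟩ := hq
  obtain ⟨q1l, q1r⟩ := abs_le.1 hq1
  obtain ⟨q2l, q2r⟩ := abs_le.1 hq2
  obtain ⟨h0, hlo, hhi, hw, -, -⟩ := hT.self_bounds h1 q2r
  have hfirst := h.isEmptyOf_firstStep h1 hk h0 (lt_of_le_of_lt hq1 (by linarith))
  unfold IsEmptyOf guards
  rw [Set.inter_union_distrib_left, hfirst, Set.empty_union, Set.eq_empty_iff_forall_notMem]
  rintro g ⟨hg, hgs⟩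
  obtain ⟨c1, c2⟩ := (mem_cone_iff_slope hs hT.1).1 hg
  set u := lo i (Real.cos φ / Real.sin φ)
  set u' := hi i (Real.cos φ / Real.sin φ)
  have hu1 : 3 * i * u' ≤ 1 := by nlinarith
  have hu2 : -1 ≤ 3 * i * u := by nlinarith
  have hg2 : 0 < g.2 - q.2 := by
    have := hi_sub_lo_pos h1 hT.1
    by_contra hneg
    push Not at hneg
    nlinarith
  have hxpos : 0 < x := by linarith
  have hr : 3 * i * (g.1 - q.1) < g.2 - q.2 := by nlinarith
  have hl : -(g.2 - q.2) < 3 * i * (g.1 - q.1) := by nlinarith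
  rcases mem_fourfold.1 hgs with hg' | hg' | hg' | hg'
  · obtain ⟨k', l', hk', hl', hkl, rfl⟩ := (mem_secondUpper_iff h1 hxpos).1 hg'
    have hd := le_abs_deepSlope h1 hk' hl' hkl
    simp only at hr hl
    rcases abs_cases (deepSlope i (k' - l')) with ⟨e, -⟩ | ⟨e, -⟩ <;> rw [e] at hd
    · have := mul_le_mul_of_nonneg_right hd hxpos.le
      nlinarith
    · have := mul_le_mul_of_nonneg_right hd hxpos.le
      nlinarith
  · obtain ⟨k', l', hk', hl', hkl, e⟩ := (mem_secondUpper_iff h1 hxpos).1 hg'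
    have hd := abs_lt.1 (abs_deepSlope_lt_one h1 hk' hl' hkl)
    simp only [Prod.mk.injEq] at e
    have : g.2 < x := by rw [e.1]; nlinarith
    nlinarith
  · obtain ⟨k', l', hk', hl', hkl, e⟩ := (mem_secondUpper_iff h1 hxpos).1 hg'
    simp only [Prod.mk.injEq] at e
    linarith
  · obtain ⟨k', l', hk', hl', hkl, e⟩ := (mem_secondUpper_iff h1 hxpos).1 hg'
    have hd := abs_lt.1 (abs_deepSlope_lt_one h1 hk' hl' hkl)
    simp only [Prod.mk.injEq] at e
    have : g.2 < x := by
      have : -g.2 > -x := by rw [e.1]; nlinarith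
      linarith
    nlinarith

/-- The apexes in `box i` of the wanted upward cones above `[a, a + 1]`. -/
def spike (i : ℕ) (a : ℝ) : Set Plane := {q | q ∈ box i ∧ ∃ v, Threads i a a q v}

theorem notMem_thetaRegion_iff {i : ℕ} (h1 : 1 ≤ i) {x : ℝ} (hx : 2000 * (i : ℝ) ^ 4 ≤ x)
    {q : Plane} (hq : q ∈ box i) :
    q ∉ thetaRegion (theta i) (guards i x) ↔
      ∃ s ∈ Finset.range 4, ∃ k : ℤ, (-(i : ℤ) ≤ k ∧ k < i) ∧ rot^[s] q ∈ spike i k := by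
  simp only [thetaRegion, Set.mem_ofPred_eq, not_forall, not_not]
  constructor
  · rintro ⟨φ, hφ⟩
    obtain ⟨s, hs, k, hk, h⟩ := isWantedCone_of_mem_box h1 hx hq hφ
    exact ⟨s, hs, k, hk, (rot_iterate_mem_box s).2 hq, _, ((passesThrough_iff h1).1 h).2⟩
  · rintro ⟨s, hs, k, hk, hb, v, hT⟩
    obtain ⟨φ, hsin, hφ⟩ := exists_angle v
    rw [← hφ] at hT
    have := ((passesThrough_iff h1).2 ⟨hsin, hT⟩).isEmptyOf_guards h1 hx hk hb
    refine ⟨φ - s * (Real.pi / 2), ?_⟩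
    rw [← isEmptyOf_rot_iterate (fun _ => rot_mem_guards) s, sub_add_cancel]
    exact this

theorem spike_bounds {i : ℕ} (h1 : 1 ≤ i) {a : ℝ} {q : Plane} (hq : q ∈ spike i a) :
    0 ≤ q.2 ∧ a + 1 / 4 ≤ q.1 ∧ q.1 ≤ a + 3 / 4 := by
  obtain ⟨hb, v, hT⟩ := hq
  obtain ⟨a1, -, -, -, a2, a3⟩ := hT.self_bounds h1 (abs_le.1 hb.2).2
  exact ⟨a1, a2, a3⟩

theorem axis_threads {i : ℕ} (h1 : 1 ≤ i) (a : ℝ) {y : ℝ} (hy : 0 ≤ y) (hy' : y ≤ i) :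
    Threads i a a (a + 1 / 2, y) 0 := by
  have hi1 : (1 : ℝ) ≤ i := by exact_mod_cast h1
  have ht := halfTan_pos h1
  have e2 := halfTan_mul h1
  have elo : lo i 0 = -halfTan i := by unfold lo; simp
  have ehi : hi i 0 = halfTan i := by unfold hi; simp
  refine ⟨⟨by simp, by simp⟩, ?_, ?_, ?_, ?_, ?_⟩
  all_goals simp only [elo, ehi]; nlinarith

theorem axis_mem_spike {i : ℕ} (h1 : 1 ≤ i) {a y : ℝ} (ha : -(i : ℝ) ≤ a) (ha' : a + 1 ≤ i)
    (hy : 0 ≤ y) (hy' : y ≤ i) : ((a + 1 / 2, y) : Plane) ∈ spike i a :=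
  ⟨⟨abs_le.2 ⟨by simp only; linarith, by simp only; linarith⟩,
    abs_le.2 ⟨by simp only; linarith, hy'⟩⟩, 0, axis_threads h1 a hy hy'⟩

/-- The rays lean to opposite sides, so raising the apex shrinks every section. -/
theorem mem_spike_of_le {i : ℕ} (h1 : 1 ≤ i) {a y : ℝ} {q : Plane} (hq : q ∈ spike i a)
    (hy : q.2 ≤ y) (hy' : y ≤ i) : ((q.1, y) : Plane) ∈ spike i a := by
  have hi1 : (1 : ℝ) ≤ i := by exact_mod_cast h1
  obtain ⟨⟨hq1, hq2⟩, v, hT⟩ := hq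
  obtain ⟨q2l, q2r⟩ := abs_le.1 hq2
  obtain ⟨h0, hlo, hhi, -⟩ := hT.self_bounds h1 q2r
  obtain ⟨hu, h2, a1, a2, a3, a4⟩ := hT
  refine ⟨⟨hq1, abs_le.2 ⟨by simp only; linarith, hy'⟩⟩, v, hu, ?_, ?_, ?_, ?_, ?_⟩
  · simp only; linarith
  all_goals simp only; nlinarith

/-- Nonnegative if and only if `p` lies in the disc of the points, to the right of the directed
line from `R` to `L`, from which the segment `LR` is seen under an angle of at least `theta i`. -/
noncomputable def discForm (i : ℕ) (L R p : Plane) : ℝ :=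
  (1 - halfTan i ^ 2) * ((R.1 - p.1) * (L.2 - p.2) - (R.2 - p.2) * (L.1 - p.1)) -
    2 * halfTan i * ((L.1 - p.1) * (R.1 - p.1) + (L.2 - p.2) * (R.2 - p.2))

/-- As a function of `p` the form is concave: its quadratic part is `-2 * halfTan i` times the
squared Euclidean norm. -/
theorem discForm_nonneg_of_convex {i : ℕ} (h1 : 1 ≤ i) {L R p q : Plane} {a b : ℝ} (ha : 0 ≤ a)
    (hb : 0 ≤ b) (hab : a + b = 1) (hp : 0 ≤ discForm i L R p) (hq : 0 ≤ discForm i L R q) :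
    0 ≤ discForm i L R (a • p + b • q) := by
  have ht := halfTan_pos h1
  have : discForm i L R (a • p + b • q) = a * discForm i L R p + b * discForm i L R q +
      2 * halfTan i * (a * b) * ((p.1 - q.1) ^ 2 + (p.2 - q.2) ^ 2) := by
    obtain rfl : b = 1 - a := by linarith
    simp only [discForm, Prod.fst_add, Prod.snd_add, Prod.smul_fst, Prod.smul_snd, smul_eq_mul]
    ring
  rw [this]
  positivity

theorem discForm_nonneg {i : ℕ} (h1 : 1 ≤ i) {L R p : Plane} {v : ℝ} (hu : Upward i v)
    (hlo : lo i v ≤ 0) (hhi : 0 ≤ hi i v) (hL : p.2 < L.2) (hR : p.2 < R.2)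
    (hL' : L.1 ≤ p.1 + lo i v * (L.2 - p.2)) (hR' : p.1 + hi i v * (R.2 - p.2) ≤ R.1) :
    0 ≤ discForm i L R p := by
  have ht := halfTan_pos h1
  have ht' := halfTan_le h1
  -- The two expressions for the tangent of the apex angle, with denominators cleared.
  have key : (hi i v - lo i v) * (1 - halfTan i ^ 2) = 2 * halfTan i * (1 + hi i v * lo i v) := by
    have a := hu.1.ne'
    have b := hu.2.ne'
    unfold hi lo
    rw [div_mul_div_comm, div_sub_div _ _ b a, div_mul_eq_mul_div,
      ← mul_right_inj' (mul_ne_zero b a)]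
    field_simp
    ring
  unfold discForm
  set t := halfTan i
  obtain ⟨x, hx⟩ : ∃ x, x = L.1 - p.1 := ⟨_, rfl⟩
  obtain ⟨y, hy⟩ : ∃ y, y = L.2 - p.2 := ⟨_, rfl⟩
  obtain ⟨x', hx'⟩ : ∃ x, x = R.1 - p.1 := ⟨_, rfl⟩
  obtain ⟨y', hy'⟩ : ∃ y, y = R.2 - p.2 := ⟨_, rfl⟩
  rw [← hx, ← hy, ← hx', ← hy']
  rw [← hy] at hL'
  rw [← hy'] at hR'
  have hy0 : 0 < y := by linarith
  have hy0' : 0 < y' := by linarith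
  obtain ⟨m, hm, hm'⟩ : ∃ m, 0 ≤ m ∧ x = lo i v * y - m := ⟨lo i v * y - x, by linarith, by ring⟩
  obtain ⟨m', hn, hn'⟩ : ∃ m, 0 ≤ m ∧ x' = hi i v * y' + m :=
    ⟨x' - hi i v * y', by linarith, by ring⟩
  have ht1 : 0 ≤ 1 - t ^ 2 := by nlinarith
  have e : (1 - t ^ 2) * (x' * y - y' * x) - 2 * t * (x * x' + y * y') =
      (1 - t ^ 2) * (m' * y + y' * m) + 2 * t * (m * x' + m' * (-lo i v * y)) := by
    rw [hm', hn']
    linear_combination y * y' * key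
  rw [e]
  have hx0 : 0 ≤ x' := by rw [hn']; positivity
  have hlo' : 0 ≤ -lo i v := by linarith
  positivity

/-- The converse of `discForm_nonneg`: once the left ray passes through `L`, the disc condition says
that the right ray does not pass beyond `R`. -/
theorem exists_slope_of_discForm {i : ℕ} (h1 : 1 ≤ i) {p : Plane} {U : ℝ} (hU : U ≤ 0) :
    ∃ v, Upward i v ∧ lo i v = U ∧ ∀ L R : Plane, p.2 < L.2 → L.1 = p.1 + U * (L.2 - p.2) →
      0 ≤ discForm i L R p → p.1 + hi i v * (R.2 - p.2) ≤ R.1 := by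
  have ht := halfTan_pos h1
  have ht' := halfTan_le h1
  obtain ⟨t, htt⟩ : ∃ t, t = halfTan i := ⟨_, rfl⟩
  rw [← htt] at ht ht'
  have hA : 0 < 1 - U * t := by nlinarith
  have hB : 0 < 1 - t ^ 2 - 2 * U * t := by nlinarith
  set v := (U + t) / (1 - U * t) with hv
  have hv' : v * (1 - U * t) = U + t := div_mul_cancel₀ _ hA.ne'
  have e1 : 1 + t * v = (1 + t ^ 2) / (1 - U * t) := by
    rw [eq_div_iff hA.ne']; linear_combination t * hv'
  have e2 : 1 - t * v = (1 - t ^ 2 - 2 * U * t) / (1 - U * t) := by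
    rw [eq_div_iff hA.ne']; linear_combination -t * hv'
  have hu : Upward i v := by
    unfold Upward
    rw [← htt, e1, e2]
    constructor <;> positivity
  have elo : lo i v = U := by
    unfold lo
    rw [← htt, e1, div_eq_iff (by positivity), hv]
    field_simp
    ring
  have ehi : hi i v = (U * (1 - t ^ 2) + 2 * t) / (1 - t ^ 2 - 2 * U * t) := by
    unfold hi
    rw [← htt, e2, hv, div_eq_div_iff (by positivity) hB.ne']
    field_simp
    ring
  refine ⟨v, hu, elo, ?_⟩
  intro L R hL hL' hD
  unfold discForm at hD
  rw [← htt, show L.1 - p.1 = U * (L.2 - p.2) by linarith] at hD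
  have hD' : 0 ≤ (L.2 - p.2) * ((R.1 - p.1) * (1 - t ^ 2 - 2 * U * t) -
      (U * (1 - t ^ 2) + 2 * t) * (R.2 - p.2)) := by
    have e : (L.2 - p.2) * ((R.1 - p.1) * (1 - t ^ 2 - 2 * U * t) -
      (U * (1 - t ^ 2) + 2 * t) * (R.2 - p.2)) = (1 - t ^ 2) * ((R.1 - p.1) * (L.2 - p.2) -
        (R.2 - p.2) * (U * (L.2 - p.2))) -
        2 * t * (U * (L.2 - p.2) * (R.1 - p.1) + (L.2 - p.2) * (R.2 - p.2)) := by ring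
    rw [e]; exact hD
  have hD'' := nonneg_of_mul_nonneg_right hD' (by linarith)
  rw [ehi, ← le_sub_iff_add_le', div_mul_eq_mul_div, div_le_iff₀ hB]
  linarith

/-- Every apex satisfies the four disc conditions, one for each pair of a left and a right guard;
these survive convex combinations and give back a cone. -/
theorem convex_spike {i : ℕ} (h1 : 1 ≤ i) (a : ℝ) : Convex ℝ (spike i a) := by
  have hi1 : (1 : ℝ) ≤ i := by exact_mod_cast h1
  have hdisc : ∀ p ∈ spike i a, ∀ L R : Plane, (L = (a, 4 * (i : ℝ)) ∨ L = (a + 1 / 4, 2 * (i : ℝ))) →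
      (R = (a + 1, 4 * (i : ℝ)) ∨ R = (a + 3 / 4, 2 * (i : ℝ))) → 0 ≤ discForm i L R p := by
    rintro p ⟨hb, v, hT⟩ L R hL hR
    obtain ⟨-, hlo, hhi, -⟩ := hT.self_bounds h1 (abs_le.1 hb.2).2
    obtain ⟨hu, h2, a1, a2, a3, a4⟩ := hT
    apply discForm_nonneg h1 hu hlo hhi
    · rcases hL with rfl | rfl <;> simp only <;> linarith
    · rcases hR with rfl | rfl <;> simp only <;> linarith
    · rcases hL with rfl | rfl <;> simp only <;> linarith
    · rcases hR with rfl | rfl <;> simp only <;> linarith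
  intro p hp q hq s t hs ht hst
  obtain ⟨p2, p3, p4⟩ := spike_bounds h1 hp
  obtain ⟨q2, q3, q4⟩ := spike_bounds h1 hq
  have hbp1 := abs_le.1 hp.1.1
  have hbp2 := abs_le.1 hp.1.2
  have hbq1 := abs_le.1 hq.1.1
  have hbq2 := abs_le.1 hq.1.2
  have hD : ∀ L R : Plane, (L = (a, 4 * (i : ℝ)) ∨ L = (a + 1 / 4, 2 * (i : ℝ))) →
      (R = (a + 1, 4 * (i : ℝ)) ∨ R = (a + 3 / 4, 2 * (i : ℝ))) → 0 ≤ discForm i L R (s • p + t • q) :=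
    fun L R hL hR => discForm_nonneg_of_convex h1 hs ht hst (hdisc p hp L R hL hR)
      (hdisc q hq L R hL hR)
  set r := s • p + t • q with hr
  have hr1 : r.1 = s * p.1 + t * q.1 := by simp [hr]
  have hr2 : r.2 = s * p.2 + t * q.2 := by simp [hr]
  have conv_le : ∀ x y c : ℝ, x ≤ c → y ≤ c → s * x + t * y ≤ c := by
    intro x y c hx hy
    calc s * x + t * y ≤ s * c + t * c := by gcongr
      _ = c := by rw [← add_mul, hst, one_mul]
  have conv_ge : ∀ x y c : ℝ, c ≤ x → c ≤ y → c ≤ s * x + t * y := by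
    intro x y c hx hy
    calc c = s * c + t * c := by rw [← add_mul, hst, one_mul]
      _ ≤ s * x + t * y := by gcongr
  have r1 : a + 1 / 4 ≤ r.1 := by rw [hr1]; exact conv_ge _ _ _ p3 q3
  have r2 : r.2 ≤ i := by rw [hr2]; exact conv_le _ _ _ hbp2.2 hbq2.2
  have hb : r ∈ box i := by
    refine ⟨abs_le.2 ⟨?_, ?_⟩, abs_le.2 ⟨?_, r2⟩⟩
    · rw [hr1]; exact conv_ge _ _ _ hbp1.1 hbq1.1
    · rw [hr1]; exact conv_le _ _ _ hbp1.2 hbq1.2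
    · rw [hr2]; exact conv_ge _ _ _ hbp2.1 hbq2.1
  have h4 : 0 < 4 * i - r.2 := by linarith
  have h2 : 0 < 2 * i - r.2 := by linarith
  -- The left ray takes the larger of the two slopes: it touches one left guard and clears the
  -- other.
  rcases le_total ((a - r.1) / (4 * i - r.2)) ((a + 1 / 4 - r.1) / (2 * i - r.2)) with hle | hle
  · obtain ⟨v, hu, hlo, hv⟩ := exists_slope_of_discForm h1 (p := r)
      (U := (a + 1 / 4 - r.1) / (2 * i - r.2)) (div_nonpos_of_nonpos_of_nonneg (by linarith) h2.le)
    have hLeq : (a + 1 / 4) = r.1 + (a + 1 / 4 - r.1) / (2 * i - r.2) * (2 * i - r.2) := by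
      field_simp; ring
    rw [div_le_iff₀ h4] at hle
    refine ⟨hb, v, hu, by linarith, by rw [hlo]; linarith, ?_, by rw [hlo, ← hLeq], ?_⟩
    · exact hv (a + 1 / 4, 2 * i) (a + 1, 4 * i) (by simp only; linarith) hLeq
        (hD _ _ (Or.inr rfl) (Or.inl rfl))
    · exact hv (a + 1 / 4, 2 * i) (a + 3 / 4, 2 * i) (by simp only; linarith) hLeq
        (hD _ _ (Or.inr rfl) (Or.inr rfl))
  · obtain ⟨v, hu, hlo, hv⟩ := exists_slope_of_discForm h1 (p := r)
      (U := (a - r.1) / (4 * i - r.2)) (div_nonpos_of_nonpos_of_nonneg (by linarith) h4.le)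
    have hLeq : a = r.1 + (a - r.1) / (4 * i - r.2) * (4 * i - r.2) := by
      field_simp; ring
    rw [div_le_iff₀ h2] at hle
    refine ⟨hb, v, hu, by linarith, by rw [hlo, ← hLeq], ?_, by rw [hlo]; linarith, ?_⟩
    · exact hv (a, 4 * i) (a + 1, 4 * i) (by simp only; linarith) hLeq
        (hD _ _ (Or.inl rfl) (Or.inl rfl))
    · exact hv (a, 4 * i) (a + 3 / 4, 2 * i) (by simp only; linarith) hLeq
        (hD _ _ (Or.inl rfl) (Or.inr rfl))

/-! ### Connected components inside the box -/

theorem exists_convex_weight {μ ν : ℝ} (h1 : 1 ≤ μ) (h2 : μ ≤ ν) :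
    ∃ s t : ℝ, 0 ≤ s ∧ 0 ≤ t ∧ s + t = 1 ∧ s + t * ν = μ := by
  rcases (h1.trans h2).eq_or_lt with h | h
  · exact ⟨1, 0, by norm_num, le_rfl, by norm_num, by linarith⟩
  · have : 0 < ν - 1 := by linarith
    refine ⟨(ν - μ) / (ν - 1), (μ - 1) / (ν - 1), div_nonneg (by linarith) this.le,
      div_nonneg (by linarith) this.le, ?_, ?_⟩
    · field_simp; ring
    · field_simp; ring

/-- Inside a grid cell, moving away from the lattice point means moving towards the axis of the
spike, so convexity keeps the point in the spike. -/
theorem spike_star {i : ℕ} (h1 : 1 ≤ i) {a m : ℝ} (ha : -(i : ℝ) ≤ a) (ha' : a + 1 ≤ i)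
    (hm : m = a ∨ m = a + 1) {n : ℤ} {ξ η μ : ℝ} (hz : ((m + ξ, n + η) : Plane) ∈ spike i a)
    (hμ : 1 ≤ μ) (hξ : |μ * ξ| < 1 / 2) (hη : |μ * η| < 1 / 2)
    (hw : ((m + μ * ξ, n + μ * η) : Plane) ∈ box i) :
    ((m + μ * ξ, n + μ * η) : Plane) ∈ spike i a := by
  obtain ⟨z0, z1, z2⟩ := spike_bounds h1 hz
  obtain ⟨z3, z4⟩ := abs_le.1 hz.1.2
  obtain ⟨w3, w4⟩ := abs_le.1 hw.2
  simp only at z0 z1 z2 z3 z4 w3 w4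
  obtain ⟨x1, x2⟩ := abs_lt.1 hξ
  obtain ⟨y1, y2⟩ := abs_lt.1 hη
  -- At parameter `ν` the ray meets the axis of the spike. The spike stays within 1/4 of its axis,
  -- so `|ξ| ≥ 1 / 4` and `ν ≤ 2`.
  obtain ⟨ν, hν, hμν, hν2⟩ : ∃ ν, m + ν * ξ = a + 1 / 2 ∧ μ ≤ ν ∧ ν ≤ 2 := by
    rcases hm with rfl | rfl
    · have hpos : 0 < ξ := by linarith
      refine ⟨1 / 2 / ξ, by field_simp, ?_, ?_⟩
      · rw [le_div_iff₀ hpos]; exact x2.le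
      · rw [div_le_iff₀ hpos]; linarith
    · have hpos : 0 < -ξ := by linarith
      have hne : ξ ≠ 0 := by rintro rfl; simp at hpos
      refine ⟨1 / 2 / (-ξ), by field_simp; ring, ?_, ?_⟩
      · rw [le_div_iff₀ hpos]; linarith
      · rw [div_le_iff₀ hpos]; linarith
  obtain ⟨s, t, hs, ht, hst, hμ'⟩ := exists_convex_weight hμ hμν
  rcases le_or_gt 0 η with h | h
  · have hle : (n : ℝ) + η ≤ n + μ * η := by nlinarith
    -- On a rising ray the start is first lifted to the height of the target, since the ray could
    -- reach the axis outside the box.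
    have hP := mem_spike_of_le h1 hz hle w4
    have hQ := axis_mem_spike h1 ha ha' (y := n + μ * η) (by linarith) w4
    have := convex_spike h1 a hP hQ hs ht hst
    convert this using 1
    ext
    · simp only [Prod.fst_add, Prod.smul_fst, smul_eq_mul]
      linear_combination -m * hst - ξ * hμ' + t * hν
    · simp only [Prod.snd_add, Prod.smul_snd, smul_eq_mul]
      linear_combination -(n + μ * η) * hst
  · have hn : (1 : ℝ) ≤ n := by
      have : (0 : ℝ) < n := by linarith
      have : 0 < n := by exact_mod_cast this
      exact_mod_cast this
    -- On a falling ray the point on the axis has nonnegative height, because `n ≥ 1`, `ν ≤ 2` and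
    -- `|η| < 1 / 2`.
    have hQ := axis_mem_spike h1 ha ha' (y := n + ν * η) (by nlinarith) (by nlinarith)
    have := convex_spike h1 a hz hQ hs ht hst
    convert this using 1
    ext
    · simp only [Prod.fst_add, Prod.smul_fst, smul_eq_mul]
      linear_combination -m * hst - ξ * hμ' + t * hν
    · simp only [Prod.snd_add, Prod.smul_snd, smul_eq_mul]
      linear_combination -n * hst - η * hμ'

theorem rot_iterate_add_smul (s : ℕ) (c d : Plane) (r : ℝ) :
    rot^[s] (c + r • d) = rot^[s] c + r • rot^[s] d := by
  induction s with
  | zero => rfl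
  | succ s ih =>
    simp only [Function.iterate_succ_apply', ih]
    ext
    · simp [rot]; ring
    · simp [rot]

theorem rot_iterate_int (s : ℕ) (m n : ℤ) :
    ∃ m' n' : ℤ, rot^[s] ((m, n) : ℝ × ℝ) = ((m', n') : ℝ × ℝ) := by
  induction s with
  | zero => exact ⟨m, n, rfl⟩
  | succ s ih =>
    obtain ⟨m', n', h⟩ := ih
    exact ⟨-n', m', by rw [Function.iterate_succ_apply', h]; simp [rot]⟩

theorem rot_iterate_abs_lt {r : ℝ} (s : ℕ) {d : Plane} (h : |d.1| < r ∧ |d.2| < r) :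
    |(rot^[s] d).1| < r ∧ |(rot^[s] d).2| < r := by
  induction s with
  | zero => exact h
  | succ s ih =>
    rw [Function.iterate_succ_apply']
    exact ⟨by simpa [rot] using ih.2, by simpa [rot] using ih.1⟩

theorem abs_int_le_of_near {i : ℕ} {m : ℤ} {y : ℝ} (hy : |y| ≤ i) (h : |y - m| < 1 / 2) :
    -(i : ℤ) ≤ m ∧ m ≤ i := by
  obtain ⟨a, b⟩ := abs_le.1 hy
  obtain ⟨c, d⟩ := abs_lt.1 h
  constructor
  · have : -(i : ℝ) < m + 1 := by linarith
    have : -(i : ℤ) < m + 1 := by exact_mod_cast this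
    omega
  · have : (m : ℝ) < i + 1 := by linarith
    have : m < i + 1 := by exact_mod_cast this
    omega

/-- If a point of the segment were in a rotated spike, `spike_star` with factor `1 / r` would put
`w` into it. -/
theorem thetaRegion_star {i : ℕ} (h1 : 1 ≤ i) {x : ℝ} (hx : 2000 * (i : ℝ) ^ 4 ≤ x)
    {m n : ℤ} {w : Plane} (hw : w ∈ thetaRegion (theta i) (guards i x) ∩ box i)
    (hm : |w.1 - m| < 1 / 2) (hn : |w.2 - n| < 1 / 2) {r : ℝ} (hr0 : 0 ≤ r) (hr1 : r ≤ 1) :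
    ((m, n) : ℝ × ℝ) + r • (w - ((m, n) : ℝ × ℝ)) ∈
      thetaRegion (theta i) (guards i x) ∩ box i := by
  set c : Plane := ((m, n) : ℝ × ℝ) with hc
  obtain ⟨hwr, hwb⟩ := hw
  have hmi := abs_int_le_of_near hwb.1 hm
  have hni := abs_int_le_of_near hwb.2 hn
  have hm1 : -(i : ℝ) ≤ m := by exact_mod_cast hmi.1
  have hm2 : (m : ℝ) ≤ i := by exact_mod_cast hmi.2
  have hn1 : -(i : ℝ) ≤ n := by exact_mod_cast hni.1
  have hn2 : (n : ℝ) ≤ i := by exact_mod_cast hni.2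
  obtain ⟨a1, a2⟩ := abs_le.1 hwb.1
  obtain ⟨b1, b2⟩ := abs_le.1 hwb.2
  have hzb : c + r • (w - c) ∈ box i := by
    refine ⟨abs_le.2 ?_, abs_le.2 ?_⟩ <;>
      simp only [hc, Prod.fst_add, Prod.snd_add, Prod.smul_fst, Prod.smul_snd, Prod.fst_sub,
        Prod.snd_sub, smul_eq_mul] <;> constructor <;> nlinarith
  refine ⟨?_, hzb⟩
  by_contra hz
  obtain ⟨s, hs, k, hk, hsp⟩ := (notMem_thetaRegion_iff h1 hx hzb).1 hz
  have k1 : -(i : ℝ) ≤ k := by exact_mod_cast hk.1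
  have k2 : (k : ℝ) + 1 ≤ i := by exact_mod_cast hk.2
  obtain ⟨m', n', hc'⟩ := rot_iterate_int s m n
  rw [← hc] at hc'
  have hd := rot_iterate_abs_lt s (d := w - c) ⟨hm, hn⟩
  have hsp' := hsp
  rw [rot_iterate_add_smul, hc'] at hsp'
  set d := rot^[s] (w - c) with hdd
  have hsp2 : ((m' + r * d.1, n' + r * d.2) : Plane) ∈ spike i k := hsp'
  obtain ⟨-, e1, e2⟩ := spike_bounds h1 hsp2
  simp only at e1 e2
  have hrd : |r * d.1| < 1 / 2 := by
    rw [abs_mul, abs_of_nonneg hr0]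
    nlinarith [abs_nonneg d.1, hd.1]
  obtain ⟨f1, f2⟩ := abs_lt.1 hrd
  have hm' : (m' : ℝ) = k ∨ (m' : ℝ) = k + 1 := by
    have g1 : k < m' + 1 := by
      have : (k : ℝ) < m' + 1 := by linarith
      exact_mod_cast this
    have g2 : m' < k + 2 := by
      have : (m' : ℝ) < k + 2 := by linarith
      exact_mod_cast this
    have : m' = k ∨ m' = k + 1 := by omega
    exact_mod_cast this
  have hrpos : 0 < r := by
    rcases hr0.eq_or_lt with h | h
    · exfalso
      rw [← h] at e1 e2
      rcases hm' with h | h <;> rw [h] at e1 e2 <;> linarith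
    · exact h
  have hcd : rot^[s] w = ((m', n') : ℝ × ℝ) + d := by
    have := rot_iterate_add_smul s c (w - c) 1
    rw [one_smul, one_smul, add_sub_cancel] at this
    rw [this, ← hc']
  have hr' : ∀ y : ℝ, 1 / r * (r * y) = y := fun y => by field_simp
  have hwsp := spike_star h1 k1 k2 hm' (n := n') (ξ := r * d.1) (η := r * d.2) (μ := 1 / r) hsp2
    (by rw [le_div_iff₀ hrpos]; linarith) (by rw [hr']; exact hd.1) (by rw [hr']; exact hd.2)
    (by
      rw [hr', hr']
      have := (rot_iterate_mem_box s).2 hwb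
      rw [hcd] at this
      exact this)
  rw [hr', hr'] at hwsp
  refine (notMem_thetaRegion_iff h1 hx hwb).2 ⟨s, hs, k, hk, ?_⟩ hwr
  rw [hcd]
  exact hwsp

theorem int_mem_thetaRegion {i : ℕ} (h1 : 1 ≤ i) {x : ℝ} (hx : 2000 * (i : ℝ) ^ 4 ≤ x) {m n : ℤ}
    (hb : ((m, n) : ℝ × ℝ) ∈ box i) :
    ((m, n) : ℝ × ℝ) ∈ thetaRegion (theta i) (guards i x) := by
  by_contra hz
  obtain ⟨s, hs, k, hk, hsp⟩ := (notMem_thetaRegion_iff h1 hx hb).1 hz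
  obtain ⟨m', n', hc'⟩ := rot_iterate_int s m n
  rw [hc'] at hsp
  obtain ⟨-, e1, e2⟩ := spike_bounds h1 hsp
  simp only at e1 e2
  have g1 : k < m' := by
    have : (k : ℝ) < m' := by linarith
    exact_mod_cast this
  have g2 : m' < k + 1 := by
    have : (m' : ℝ) < k + 1 := by linarith
    exact_mod_cast this
  omega

theorem grid_notMem_thetaRegion {i : ℕ} (h1 : 1 ≤ i) {x : ℝ} (hx : 2000 * (i : ℝ) ^ 4 ≤ x)
    {k : ℤ} {w : Plane} (hw : w ∈ box i) (h : w.1 = k + 1 / 2 ∨ w.2 = k + 1 / 2) :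
    w ∉ thetaRegion (theta i) (guards i x) := by
  rw [notMem_thetaRegion_iff h1 hx hw]
  obtain ⟨a1, a2⟩ := abs_le.1 hw.1
  obtain ⟨b1, b2⟩ := abs_le.1 hw.2
  have hrange : ∀ y : ℝ, -(i : ℝ) ≤ y → y ≤ i → y = k + 1 / 2 → -(i : ℤ) ≤ k ∧ k < i := by
    intro y hy1 hy2 e
    have g1 : -(i : ℤ) < k + 1 := by
      have : -(i : ℝ) < k + 1 := by linarith
      exact_mod_cast this
    have g2 : k < i := by
      have : (k : ℝ) < i := by linarith
      exact_mod_cast this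
    exact ⟨by omega, g2⟩
  have hax : ∀ y : ℝ, 0 ≤ y → y ≤ i → ∀ z : ℝ, ∀ j : ℤ, -(i : ℤ) ≤ j ∧ j < i → z = j + 1 / 2 →
      ((z, y) : Plane) ∈ spike i j := by
    rintro y hy1 hy2 z j hj rfl
    exact axis_mem_spike h1 (by exact_mod_cast hj.1) (by exact_mod_cast hj.2) hy1 hy2
  rcases h with h | h
  · have hk := hrange _ a1 a2 h
    rcases le_total 0 w.2 with h0 | h0
    · exact ⟨0, by simp, k, hk, hax _ h0 b2 _ _ hk h⟩
    · refine ⟨2, by simp, -k - 1, by omega, ?_⟩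
      exact hax (-w.2) (by linarith) (by linarith) (-w.1) _ (by omega)
        (by rw [h]; push_cast; ring)
  · have hk := hrange _ b1 b2 h
    rcases le_total 0 w.1 with h0 | h0
    · refine ⟨1, by simp, -k - 1, by omega, ?_⟩
      exact hax w.1 h0 a2 (-w.2) _ (by omega) (by rw [h]; push_cast; ring)
    · refine ⟨3, by simp, k, hk, ?_⟩
      have := hax (-w.1) (by linarith) (by linarith) w.2 k hk h
      simpa [rot] using this

theorem abs_sub_round_lt {i : ℕ} (h1 : 1 ≤ i) {x : ℝ} (hx : 2000 * (i : ℝ) ^ 4 ≤ x) {w : Plane}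
    (hw : w ∈ thetaRegion (theta i) (guards i x) ∩ box i) :
    |w.1 - round w.1| < 1 / 2 ∧ |w.2 - round w.2| < 1 / 2 := by
  have key : ∀ y : ℝ, (∀ k : ℤ, y ≠ k + 1 / 2) → |y - round y| < 1 / 2 := by
    intro y hy
    refine lt_of_le_of_ne (abs_sub_round y) fun h => ?_
    rcases (abs_eq (by norm_num)).1 h with h | h
    · exact hy (round y) (by linarith)
    · exact hy (round y - 1) (by push_cast; linarith)
  exact ⟨key _ fun k e => grid_notMem_thetaRegion h1 hx hw.2 (Or.inl e) hw.1,
    key _ fun k e => grid_notMem_thetaRegion h1 hx hw.2 (Or.inr e) hw.1⟩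

theorem round_eq_of_abs_sub_lt {y : ℝ} {m : ℤ} (h : |y - m| < 1 / 2) : round y = m := by
  obtain ⟨a, b⟩ := abs_lt.1 h
  rw [round_eq, Int.floor_eq_iff]
  constructor <;> linarith

/-- A continuous map to a totally disconnected space with preconnected fibres identifies the
connected components with its range. -/
theorem card_connectedComponents_eq_card_range {X Y : Type*} [TopologicalSpace X]
    [TopologicalSpace Y] [TotallyDisconnectedSpace Y] {f : X → Y} (hf : Continuous f)
    (hfib : ∀ y, IsPreconnected (f ⁻¹' {y})) :
    Nat.card (ConnectedComponents X) = Nat.card (Set.range f) := by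
  have hinj : Function.Injective hf.connectedComponentsLift := by
    intro a b
    obtain ⟨a, rfl⟩ := ConnectedComponents.surjective_coe a
    obtain ⟨b, rfl⟩ := ConnectedComponents.surjective_coe b
    intro h
    rw [Continuous.connectedComponentsLift_apply_coe,
      Continuous.connectedComponentsLift_apply_coe] at h
    rw [ConnectedComponents.coe_eq_coe']
    exact (hfib (f b)).subset_connectedComponent rfl h
  rw [← Nat.card_range_of_injective hinj]
  congr 2
  ext y
  constructor
  · rintro ⟨a, rfl⟩
    obtain ⟨a, rfl⟩ := ConnectedComponents.surjective_coe a
    exact ⟨a, (hf.connectedComponentsLift_apply_coe a).symm⟩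
  · rintro ⟨a, rfl⟩
    exact ⟨a, hf.connectedComponentsLift_apply_coe a⟩

/-- Rounding to the nearest lattice point is continuous because the region avoids the half-integer
grid; its fibres are star-shaped. -/
theorem card_connectedComponents_thetaRegion {i : ℕ} (h1 : 1 ≤ i) {x : ℝ}
    (hx : 2000 * (i : ℝ) ^ 4 ≤ x) :
    Nat.card (ConnectedComponents ↥(thetaRegion (theta i) (guards i x) ∩ box i)) =
      (2 * i + 1) ^ 2 := by
  set S := thetaRegion (theta i) (guards i x) ∩ box i with hS
  set f : S → ℤ × ℤ := fun w => (round w.1.1, round w.1.2) with hf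
  have hnear : ∀ w : S, |w.1.1 - round w.1.1| < 1 / 2 ∧ |w.1.2 - round w.1.2| < 1 / 2 :=
    fun w => abs_sub_round_lt h1 hx w.2
  have hcont : Continuous f := by
    rw [continuous_discrete_rng]
    rintro ⟨m, n⟩
    have : f ⁻¹' {(m, n)} = {w : S | |w.1.1 - m| < 1 / 2 ∧ |w.1.2 - n| < 1 / 2} := by
      ext w
      simp only [Set.mem_preimage, Set.mem_singleton_iff, hf, Prod.mk.injEq, Set.mem_ofPred_eq]
      constructor
      · rintro ⟨rfl, rfl⟩; exact hnear w
      · rintro ⟨a, b⟩; exact ⟨round_eq_of_abs_sub_lt a, round_eq_of_abs_sub_lt b⟩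
    rw [this]
    have o1 : IsOpen {w : S | |w.1.1 - m| < 1 / 2} := isOpen_lt (by fun_prop) (by fun_prop)
    have o2 : IsOpen {w : S | |w.1.2 - n| < 1 / 2} := isOpen_lt (by fun_prop) (by fun_prop)
    exact o1.inter o2
  have hfib : ∀ y, IsPreconnected (f ⁻¹' {y}) := by
    rintro ⟨m, n⟩
    rcases (f ⁻¹' {(m, n)}).eq_empty_or_nonempty with h | ⟨w₀, hw₀⟩
    · rw [h]; exact isPreconnected_empty
    have hclose : ∀ w ∈ f ⁻¹' {(m, n)}, |w.1.1 - m| < 1 / 2 ∧ |w.1.2 - n| < 1 / 2 := by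
      intro w hw
      simp only [Set.mem_preimage, Set.mem_singleton_iff, hf, Prod.mk.injEq] at hw
      have := hnear w
      rwa [hw.1, hw.2] at this
    have hpath : ∀ w ∈ f ⁻¹' {(m, n)}, ∀ r : unitInterval,
        ((m, n) : ℝ × ℝ) + (r : ℝ) • (w.1 - ((m, n) : ℝ × ℝ)) ∈ S := fun w hw r =>
      thetaRegion_star h1 hx w.2 (hclose w hw).1 (hclose w hw).2 r.2.1 r.2.2
    have hc0 : ((m, n) : ℝ × ℝ) ∈ S := by simpa using hpath w₀ hw₀ 0
    refine isPreconnected_of_forall ⟨((m, n) : ℝ × ℝ), hc0⟩ fun w hw => ?_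
    refine ⟨Set.range fun r : unitInterval => (⟨_, hpath w hw r⟩ : S), ?_, ?_, ?_, ?_⟩
    · rintro _ ⟨r, rfl⟩
      obtain ⟨a, b⟩ := hclose w hw
      simp only [Set.mem_preimage, Set.mem_singleton_iff, hf, Prod.mk.injEq]
      have hle : ∀ y : ℝ, |y| < 1 / 2 → |(r : ℝ) * y| < 1 / 2 := by
        intro y hy
        rw [abs_mul, abs_of_nonneg r.2.1]
        exact lt_of_le_of_lt (mul_le_of_le_one_left (abs_nonneg y) r.2.2) hy
      constructor
      · apply round_eq_of_abs_sub_lt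
        simpa using hle _ a
      · apply round_eq_of_abs_sub_lt
        simpa using hle _ b
    · exact ⟨0, by simp⟩
    · exact ⟨1, by simp⟩
    · exact isPreconnected_range (Continuous.subtype_mk (by fun_prop) _)
  rw [card_connectedComponents_eq_card_range hcont hfib]
  have hrange : Set.range f =
      ↑(Finset.Icc (-(i : ℤ)) i ×ˢ Finset.Icc (-(i : ℤ)) i) := by
    ext ⟨m, n⟩
    simp only [Set.mem_range, Finset.coe_product, Finset.coe_Icc, Set.mem_prod, Set.mem_Icc]
    constructor
    · rintro ⟨w, hw⟩
      simp only [hf, Prod.mk.injEq] at hw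
      have := hnear w
      rw [hw.1, hw.2] at this
      exact ⟨abs_int_le_of_near w.2.2.1 this.1, abs_int_le_of_near w.2.2.2 this.2⟩
    · rintro ⟨⟨a, b⟩, ⟨c, d⟩⟩
      have hb : ((m, n) : ℝ × ℝ) ∈ box i :=
        ⟨abs_le.2 ⟨by simp only; exact_mod_cast a, by simp only; exact_mod_cast b⟩,
          abs_le.2 ⟨by simp only; exact_mod_cast c, by simp only; exact_mod_cast d⟩⟩
      exact ⟨⟨((m, n) : ℝ × ℝ), int_mem_thetaRegion h1 hx hb, hb⟩, by simp [hf]⟩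
  rw [hrange, Nat.card_coe_set_eq, Set.ncard_coe_finset, Finset.card_product, Int.card_Icc,
    show ((i : ℤ) + 1 - -i).toNat = 2 * i + 1 by omega, pow_two]

/-! ### Complexity -/

theorem rot_mem_thetaRegion {i : ℕ} {x : ℝ} {q : Plane} :
    rot q ∈ thetaRegion (theta i) (guards i x) ↔ q ∈ thetaRegion (theta i) (guards i x) := by
  simp only [thetaRegion, Set.mem_ofPred_eq]
  constructor
  · intro h φ
    have := h (φ + Real.pi / 2)
    rwa [isEmptyOf_rot (fun _ => rot_mem_guards)] at this
  · intro h φ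
    have := h (φ - Real.pi / 2)
    rwa [← isEmptyOf_rot (fun _ => rot_mem_guards), sub_add_cancel] at this

/-- The vertical wanted cone with apex `(k + 1/2, 0)` is open, contains `w`, and misses the region
because cones translated to its points stay inside it. -/
theorem notMem_closure_thetaRegion {i : ℕ} (h1 : 1 ≤ i) {x : ℝ} (hx : 2000 * (i : ℝ) ^ 4 ≤ x)
    {k : ℤ} (hk : -(i : ℤ) ≤ k ∧ k < i) {w : Plane} (hw : w.1 = k + 1 / 2) (hw2 : 0 < w.2) :
    w ∉ closure (thetaRegion (theta i) (guards i x)) := by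
  have hi0 : (0 : ℝ) ≤ i := Nat.cast_nonneg i
  obtain ⟨φ, hs, hφ⟩ := exists_angle 0
  have hT := axis_threads h1 (k : ℝ) le_rfl hi0
  have hb := (axis_mem_spike h1 (a := k) (by exact_mod_cast hk.1) (by exact_mod_cast hk.2)
    le_rfl hi0).1
  have hT : Threads i k k (k + 1 / 2, 0) (Real.cos φ / Real.sin φ) := by rw [hφ]; exact hT
  have hemp := ((passesThrough_iff h1).2 ⟨hs, hT⟩).isEmptyOf_guards h1 hx hk hb
  rw [mem_closure_iff]
  intro h
  obtain ⟨q, hq, hqr⟩ := h _ (isOpen_cone i (k + 1 / 2, 0) φ) (by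
    rw [mem_cone_iff_slope hs hT.1, hφ]
    have ht := halfTan_pos h1
    unfold lo hi
    simp only [zero_sub, mul_zero, add_zero, div_one, sub_zero, zero_add, hw, sub_self]
    constructor <;> nlinarith)
  exact hqr φ (Set.eq_empty_of_subset_empty fun g hg =>
    hemp ▸ (⟨cone_subset_cone hq hg.1, hg.2⟩ : g ∈ cone (theta i) (k + 1 / 2, 0) φ ∩ guards i x))

theorem notMem_closure_thetaRegion' {i : ℕ} (h1 : 1 ≤ i) {x : ℝ} (hx : 2000 * (i : ℝ) ^ 4 ≤ x)
    {k : ℤ} (hk : -(i : ℤ) ≤ k ∧ k < i) {w : Plane} (hw : w.2 = k + 1 / 2) (hw1 : 0 < w.1) :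
    w ∉ closure (thetaRegion (theta i) (guards i x)) := by
  intro h
  have hmaps : Set.MapsTo rot (thetaRegion (theta i) (guards i x))
      (thetaRegion (theta i) (guards i x)) := fun q hq => rot_mem_thetaRegion.2 hq
  have hcont : Continuous rot := by unfold rot; fun_prop
  exact notMem_closure_thetaRegion h1 hx (k := -k - 1) (by omega) (w := rot w)
    (by simp only [rot, hw]; push_cast; ring) hw1 (map_mem_closure hcont h hmaps)

theorem inter_frontier_nonempty_of_isPreconnected {X : Type*} [TopologicalSpace X] {t s : Set X}
    (ht : IsPreconnected t) (h1 : (t ∩ s).Nonempty) (h2 : (t ∩ sᶜ).Nonempty) :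
    (t ∩ frontier s).Nonempty := by
  by_contra hne
  have hnf : ∀ y ∈ t, y ∉ frontier s := fun y hy hyf => hne ⟨y, hy, hyf⟩
  obtain ⟨y, hy, hys⟩ := h1
  obtain ⟨z, hz, hzs⟩ := h2
  have hsub : t ⊆ interior s := by
    refine ht.subset_left_of_subset_union isOpen_interior isClosed_closure.isOpen_compl
      (Set.disjoint_compl_right_iff_subset.2 (interior_subset.trans subset_closure)) ?_
      ⟨y, hy, ?_⟩
    · intro w hw
      by_cases h : w ∈ closure s
      · exact Or.inl (by_contra fun h' => hnf w hw ⟨h, h'⟩)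
      · exact Or.inr h
    · exact by_contra fun h' => hnf y hy ⟨subset_closure hys, h'⟩
  exact hzs (interior_subset (hsub hz))

theorem IsBoundaryEdge.isPreconnected {S : Set Plane} (h : IsBoundaryEdge S) :
    IsPreconnected S := by
  rcases h with ⟨c, r, a, b, -, -, rfl⟩ | ⟨p, q, rfl⟩
  · exact isPreconnected_Icc.image _ (by fun_prop)
  · exact (convex_segment p q).isPreconnected

/-- The open unit cell around a lattice point. -/
def cell (m n : ℤ) : Set Plane := {w | |w.1 - m| < 1 / 2 ∧ |w.2 - n| < 1 / 2}

/-- The closed unit cell around a lattice point. -/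
def closedCell (m n : ℤ) : Set Plane := {w | |w.1 - m| ≤ 1 / 2 ∧ |w.2 - n| ≤ 1 / 2}

theorem isOpen_cell (m n : ℤ) : IsOpen (cell m n) := by
  have o1 : IsOpen {w : Plane | |w.1 - m| < 1 / 2} := isOpen_lt (by fun_prop) (by fun_prop)
  have o2 : IsOpen {w : Plane | |w.2 - n| < 1 / 2} := isOpen_lt (by fun_prop) (by fun_prop)
  exact o1.inter o2

theorem isClosed_closedCell (m n : ℤ) : IsClosed (closedCell m n) := by
  have o1 : IsClosed {w : Plane | |w.1 - m| ≤ 1 / 2} := isClosed_le (by fun_prop) (by fun_prop)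
  have o2 : IsClosed {w : Plane | |w.2 - n| ≤ 1 / 2} := isClosed_le (by fun_prop) (by fun_prop)
  exact o1.inter o2

theorem cell_subset_closedCell (m n : ℤ) : cell m n ⊆ closedCell m n :=
  fun _ h => ⟨h.1.le, h.2.le⟩

theorem frontier_inter_closedCell_subset {i : ℕ} (h1 : 1 ≤ i) {x : ℝ}
    (hx : 2000 * (i : ℝ) ^ 4 ≤ x) {m n : ℤ} (hm : 1 ≤ m ∧ m < i) (hn : 1 ≤ n ∧ n < i) :
    frontier (thetaRegion (theta i) (guards i x)) ∩ closedCell m n ⊆ cell m n := by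
  rintro w ⟨hw, h3, h4⟩
  have hm1 : (1 : ℝ) ≤ m := by exact_mod_cast hm.1
  have hn1 : (1 : ℝ) ≤ n := by exact_mod_cast hn.1
  obtain ⟨a1, a2⟩ := abs_le.1 h3
  obtain ⟨b1, b2⟩ := abs_le.1 h4
  have hcl := frontier_subset_closure hw
  refine ⟨lt_of_le_of_ne h3 fun h => ?_, lt_of_le_of_ne h4 fun h => ?_⟩
  · rcases (abs_eq (by norm_num)).1 h with h | h
    · exact notMem_closure_thetaRegion h1 hx (k := m) (by omega) (by linarith) (by linarith) hcl
    · exact notMem_closure_thetaRegion h1 hx (k := m - 1) (by omega) (by push_cast; linarith)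
        (by linarith) hcl
  · rcases (abs_eq (by norm_num)).1 h with h | h
    · exact notMem_closure_thetaRegion' h1 hx (k := n) (by omega) (by linarith) (by linarith) hcl
    · exact notMem_closure_thetaRegion' h1 hx (k := n - 1) (by omega) (by push_cast; linarith)
        (by linarith) hcl

theorem frontier_inter_cell_nonempty {i : ℕ} (h1 : 1 ≤ i) {x : ℝ} (hx : 2000 * (i : ℝ) ^ 4 ≤ x)
    {m n : ℤ} (hm : 1 ≤ m ∧ m < i) (hn : 1 ≤ n ∧ n < i) :
    (frontier (thetaRegion (theta i) (guards i x)) ∩ cell m n).Nonempty := by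
  have hm1 : (1 : ℝ) ≤ m := by exact_mod_cast hm.1
  have hm2 : (m : ℝ) + 1 ≤ i := by exact_mod_cast hm.2
  have hn1 : (1 : ℝ) ≤ n := by exact_mod_cast hn.1
  have hn2 : (n : ℝ) + 1 ≤ i := by exact_mod_cast hn.2
  have hb : ((m, n) : ℝ × ℝ) ∈ box i :=
    ⟨abs_le.2 ⟨by simp only; linarith, by simp only; linarith⟩,
      abs_le.2 ⟨by simp only; linarith, by simp only; linarith⟩⟩
  have hb' : ((m + 1 / 2, n) : ℝ × ℝ) ∈ box i :=
    ⟨abs_le.2 ⟨by simp only; linarith, by simp only; linarith⟩,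
      abs_le.2 ⟨by simp only; linarith, by simp only; linarith⟩⟩
  have hc := int_mem_thetaRegion h1 hx hb
  have hg := grid_notMem_thetaRegion h1 hx hb' (Or.inl rfl)
  have hconv : Convex ℝ (closedCell m n) := by
    have e : closedCell m n = Set.Icc ((m : ℝ) - 1 / 2) (m + 1 / 2) ×ˢ
        Set.Icc ((n : ℝ) - 1 / 2) (n + 1 / 2) := by
      ext w
      simp only [closedCell, Set.mem_ofPred_eq, abs_le, Set.mem_prod, Set.mem_Icc]
      constructor <;> rintro ⟨⟨a, b⟩, c, d⟩ <;>
        exact ⟨⟨by linarith, by linarith⟩, by linarith, by linarith⟩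
    rw [e]
    exact (convex_Icc _ _).prod (convex_Icc _ _)
  obtain ⟨z, hz, hzf⟩ := inter_frontier_nonempty_of_isPreconnected hconv.isPreconnected
    (s := thetaRegion (theta i) (guards i x))
    ⟨((m, n) : ℝ × ℝ), by simp [closedCell], hc⟩
    ⟨((m + 1 / 2, n) : ℝ × ℝ), by simp [closedCell], hg⟩
  exact ⟨z, hzf, frontier_inter_closedCell_subset h1 hx hm hn ⟨hzf, hz⟩⟩

/-- An edge through a cell is connected and avoids the border of the cell, so it stays inside;
distinct cells therefore have distinct edges. -/
theorem sq_le_card_of_cover {i : ℕ} (h1 : 1 ≤ i) {x : ℝ} (hx : 2000 * (i : ℝ) ^ 4 ≤ x)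
    {A : Finset (Set Plane)} (hA : ∀ a ∈ A, IsBoundaryEdge a)
    (hU : ⋃ a ∈ A, a = frontier (thetaRegion (theta i) (guards i x))) :
    (i - 1) ^ 2 ≤ A.card := by
  classical
  have hex : ∀ c : ℤ × ℤ, c ∈ Finset.Ico (1 : ℤ) i ×ˢ Finset.Ico (1 : ℤ) i →
      ∃ S ∈ A, S.Nonempty ∧ S ⊆ cell c.1 c.2 := by
    rintro ⟨m, n⟩ hc
    simp only [Finset.mem_product, Finset.mem_Ico] at hc
    obtain ⟨z, hzf, hz⟩ := frontier_inter_cell_nonempty h1 hx hc.1 hc.2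
    rw [← hU] at hzf
    simp only [Set.mem_iUnion, exists_prop] at hzf
    obtain ⟨S, hS, hzS⟩ := hzf
    have hSf : S ⊆ frontier (thetaRegion (theta i) (guards i x)) :=
      hU ▸ Set.subset_biUnion_of_mem (u := fun a : Set Plane => a) hS
    refine ⟨S, hS, ⟨z, hzS⟩, ?_⟩
    refine (hA S hS).isPreconnected.subset_left_of_subset_union (isOpen_cell m n)
      (isClosed_closedCell m n).isOpen_compl
      (Set.disjoint_compl_right_iff_subset.2 (cell_subset_closedCell m n)) ?_ ⟨z, hzS, hz⟩
    intro w hw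
    by_cases h : w ∈ closedCell m n
    · exact Or.inl (frontier_inter_closedCell_subset h1 hx hc.1 hc.2 ⟨hSf hw, h⟩)
    · exact Or.inr h
  choose! F hFA hFne hFsub using hex
  have hcard := Finset.card_le_card_of_injOn F hFA (by
    rintro ⟨m, n⟩ hc ⟨m', n'⟩ hc' he
    obtain ⟨w, hw⟩ := hFne _ hc
    have a := hFsub _ hc hw
    rw [he] at hw
    have b := hFsub _ hc' hw
    rw [Prod.mk.injEq]
    exact ⟨(round_eq_of_abs_sub_lt a.1).symm.trans (round_eq_of_abs_sub_lt b.1),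
      (round_eq_of_abs_sub_lt a.2).symm.trans (round_eq_of_abs_sub_lt b.2)⟩)
  rw [Finset.card_product, Int.card_Ico, show ((i : ℤ) - 1).toNat = i - 1 by omega,
    ← pow_two] at hcard
  exact hcard

theorem frontier_thetaRegion_nonempty {i : ℕ} (h1 : 1 ≤ i) {x : ℝ} (hx : 2000 * (i : ℝ) ^ 4 ≤ x) :
    (frontier (thetaRegion (theta i) (guards i x))).Nonempty := by
  have hi1 : (1 : ℝ) ≤ i := by exact_mod_cast h1
  rw [nonempty_frontier_iff]
  refine ⟨⟨_, int_mem_thetaRegion h1 hx (m := 0) (n := 0) (by simp [box])⟩, fun h => ?_⟩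
  refine grid_notMem_thetaRegion h1 hx (k := 0) (w := (1 / 2, 0)) ?_ (Or.inl (by simp))
    (h ▸ Set.mem_univ _)
  exact ⟨abs_le.2 ⟨by simp only; linarith, by simp only; linarith⟩, by simp⟩

/-- The maximum with 1 is needed for `i = 1`, where there are no cells to count. -/
theorem le_complexity_thetaRegion {i : ℕ} (h1 : 1 ≤ i) {x : ℝ} (hx : 2000 * (i : ℝ) ^ 4 ≤ x) :
    ((max ((i - 1) ^ 2) 1 : ℕ) : ℕ∞) ≤ complexity (thetaRegion (theta i) (guards i x)) := by
  unfold complexity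
  refine le_iInf₂ fun A hA => ?_
  rw [Nat.cast_le, max_le_iff]
  refine ⟨sq_le_card_of_cover h1 hx hA.1 hA.2, Finset.card_pos.2 ?_⟩
  obtain ⟨z, hz⟩ := frontier_thetaRegion_nonempty h1 hx
  rw [← hA.2] at hz
  simp only [Set.mem_iUnion, exists_prop] at hz
  obtain ⟨S, hS, -⟩ := hz
  exact ⟨S, hS⟩

/-! ### Counting the guards -/

/-- A fundamental domain of the rotation by a right angle on the punctured plane. -/
def sector : Set Plane := {q | 0 < q.2 ∧ -q.2 ≤ q.1 ∧ q.1 < q.2}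

theorem fourfold_finite {S : Set Plane} (hS : S.Finite) : (fourfold S).Finite := by
  unfold fourfold
  exact (Finset.range 4).finite_toSet.biUnion fun s _ => hS.image _

theorem ncard_fourfold {S : Set Plane} (hS : S.Finite) (hsub : S ⊆ sector) :
    (fourfold S).ncard = 4 * S.ncard := by
  classical
  lift S to Finset Plane using hS
  have e : fourfold (S : Set Plane) =
      ↑((Finset.range 4).biUnion fun s => S.image (rot^[s])) := by
    unfold fourfold
    simp
  have hS' : ∀ q ∈ S, 0 < q.2 ∧ -q.2 ≤ q.1 ∧ q.1 < q.2 := fun q hq => hsub hq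
  rw [e, Set.ncard_coe_finset, Set.ncard_coe_finset, Finset.card_biUnion]
  · rw [Finset.sum_congr rfl fun s _ =>
      Finset.card_image_of_injective S (rot_bijective.injective.iterate s)]
    simp
  · intro s hs t ht hst
    rw [Finset.mem_coe, Finset.mem_range] at hs ht
    rw [Function.onFun, Finset.disjoint_left]
    intro q hq hq'
    obtain ⟨a, ha, rfl⟩ := Finset.mem_image.1 hq
    obtain ⟨b, hb, hab⟩ := Finset.mem_image.1 hq'
    obtain ⟨a1, a2, a3⟩ := hS' a ha
    obtain ⟨b1, b2, b3⟩ := hS' b hb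
    interval_cases s <;> interval_cases t <;> first
      | exact hst rfl
      | (simp only [Function.iterate_succ, Function.iterate_zero, Function.comp, id, rot,
          Prod.ext_iff] at hab
         obtain ⟨h1, h2⟩ := hab
         linarith)

theorem fourfold_subset {S T : Set Plane} (h : S ⊆ fourfold T) : fourfold S ⊆ fourfold T := by
  intro q hq
  unfold fourfold at hq
  simp only [Set.mem_iUnion, Set.mem_image] at hq
  obtain ⟨s, -, g, hg, rfl⟩ := hq
  induction s with
  | zero => exact h hg
  | succ s ih => rw [Function.iterate_succ_apply', rot_mem_fourfold]; exact ih

/-- The guards of the first step in `sector`, in coordinates scaled by `(4, 1)`. -/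
noncomputable def upperCodes (i : ℕ) : Finset (ℤ × ℤ) :=
  (Finset.Ico (-(4 * (i : ℤ))) (4 * i)).image (fun m => (4 * m, 4 * (i : ℤ))) ∪
  ((Finset.Ico (-(4 * (i : ℤ))) (-i)).image (fun m => (4 * m + 2, 4 * (i : ℤ))) ∪
  ((Finset.Ico (i : ℤ) (4 * i)).image (fun m => (4 * m + 2, 4 * (i : ℤ))) ∪
  ((Finset.Ico (-(i : ℤ)) (i + 1)).image (fun m => (4 * m, 2 * (i : ℤ))) ∪
  ((Finset.Ico (-(i : ℤ)) i).image (fun m => (4 * m + 1, 2 * (i : ℤ))) ∪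
  (Finset.Ico (-(i : ℤ)) i).image (fun m => (4 * m + 3, 2 * (i : ℤ)))))))

theorem card_upperCodes {i : ℕ} (h1 : 1 ≤ i) : (upperCodes i).card = 20 * i + 1 := by
  unfold upperCodes
  repeat rw [Finset.card_union_of_disjoint]
  · repeat rw [Finset.card_image_of_injective]
    · simp only [Int.card_Ico]
      omega
    all_goals
      intro a b h
      simp only [Prod.mk.injEq] at h
      omega
  all_goals
    rw [Finset.disjoint_left]
    rintro ⟨a, b⟩ h h'
    simp only [Finset.mem_union, Finset.mem_image, Finset.mem_Ico, Prod.mk.injEq] at h h'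
    omega

/-- The point with the given scaled coordinates. -/
noncomputable def ofCode (c : ℤ × ℤ) : Plane := ((c.1 : ℝ) / 4, (c.2 : ℝ))

theorem ofCode_injective : Function.Injective ofCode := by
  rintro ⟨a, b⟩ ⟨c, d⟩ h
  simp only [ofCode, Prod.mk.injEq] at h
  obtain ⟨h1, h2⟩ := h
  have h3 : (a : ℝ) = c := by linarith
  rw [Prod.mk.injEq]
  exact ⟨by exact_mod_cast h3, by exact_mod_cast h2⟩

theorem ofCode_upperCodes_subset {i : ℕ} (h1 : 1 ≤ i) :
    ofCode '' (upperCodes i) ⊆ firstUpper i := by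
  rintro _ ⟨c, hc, rfl⟩
  simp only [upperCodes, Finset.coe_union, Finset.coe_image, Finset.coe_Ico, Set.mem_union,
    Set.mem_image, Set.mem_Ico] at hc
  rcases hc with ⟨m, hm, rfl⟩ | ⟨m, hm, rfl⟩ | ⟨m, hm, rfl⟩ | ⟨m, hm, rfl⟩ | ⟨m, hm, rfl⟩ |
    ⟨m, hm, rfl⟩
  · have e : ofCode (4 * m, 4 * (i : ℤ)) = ((m : ℝ), 4 * (i : ℝ)) := by
      unfold ofCode; push_cast; congr 1; ring
    rw [e]
    exact (int_mem_firstUpper hm.1 hm.2).1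
  · have e : ofCode (4 * m + 2, 4 * (i : ℤ)) = ((m : ℝ) + 1 / 2, 4 * (i : ℝ)) := by
      unfold ofCode; push_cast; congr 1; ring
    rw [e]
    exact Or.inr ⟨m, hm.1, by omega, by omega, by simp [patternB]⟩
  · have e : ofCode (4 * m + 2, 4 * (i : ℤ)) = ((m : ℝ) + 1 / 2, 4 * (i : ℝ)) := by
      unfold ofCode; push_cast; congr 1; ring
    rw [e]
    exact Or.inr ⟨m, by omega, hm.2, by omega, by simp [patternB]⟩
  · have e : ofCode (4 * m, 2 * (i : ℤ)) = ((m : ℝ), 2 * (i : ℝ)) := by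
      unfold ofCode; push_cast; congr 1; ring
    rw [e]
    by_cases h : m < i
    · exact mem_patternA_firstUpper ⟨hm.1, h⟩ (by simp [patternA])
    · exact mem_patternA_firstUpper (m := m - 1) ⟨by omega, by omega⟩ (by simp [patternA])
  · have e : ofCode (4 * m + 1, 2 * (i : ℤ)) = ((m : ℝ) + 1 / 4, 2 * (i : ℝ)) := by
      unfold ofCode; push_cast; congr 1; ring
    rw [e]
    exact mem_patternA_firstUpper hm (by simp [patternA])
  · have e : ofCode (4 * m + 3, 2 * (i : ℤ)) = ((m : ℝ) + 3 / 4, 2 * (i : ℝ)) := by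
      unfold ofCode; push_cast; congr 1; ring
    rw [e]
    exact mem_patternA_firstUpper hm (by simp [patternA])

theorem firstUpper_subset {i : ℕ} (h1 : 1 ≤ i) :
    firstUpper i ⊆ fourfold (ofCode '' (upperCodes i)) := by
  have key : ∀ (c : ℤ × ℤ) (q : Plane), c ∈ upperCodes i → ofCode c = q →
      q ∈ fourfold (ofCode '' (upperCodes i)) :=
    fun c q hc hq => mem_fourfold.2 (Or.inl ⟨c, hc, hq⟩)
  have mem : ∀ c : ℤ × ℤ, c ∈ upperCodes i ↔
      (∃ m, (-(4 * (i : ℤ)) ≤ m ∧ m < 4 * i) ∧ (4 * m, 4 * (i : ℤ)) = c) ∨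
      (∃ m, (-(4 * (i : ℤ)) ≤ m ∧ m < -i) ∧ (4 * m + 2, 4 * (i : ℤ)) = c) ∨
      (∃ m, ((i : ℤ) ≤ m ∧ m < 4 * i) ∧ (4 * m + 2, 4 * (i : ℤ)) = c) ∨
      (∃ m, (-(i : ℤ) ≤ m ∧ m < i + 1) ∧ (4 * m, 2 * (i : ℤ)) = c) ∨
      (∃ m, (-(i : ℤ) ≤ m ∧ m < i) ∧ (4 * m + 1, 2 * (i : ℤ)) = c) ∨
      (∃ m, (-(i : ℤ) ≤ m ∧ m < i) ∧ (4 * m + 3, 2 * (i : ℤ)) = c) := by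
    intro c
    simp only [upperCodes, Finset.mem_union, Finset.mem_image, Finset.mem_Ico]
  have top : ∀ m : ℤ, -(4 * (i : ℤ)) ≤ m → m < 4 * i →
      (((m : ℝ), 4 * (i : ℝ)) : Plane) ∈ fourfold (ofCode '' (upperCodes i)) := fun m h h' =>
    key (4 * m, 4 * i) _ ((mem _).2 (Or.inl ⟨m, ⟨h, h'⟩, rfl⟩))
      (by unfold ofCode; push_cast; congr 1; ring)
  have mid : ∀ m : ℤ, -(i : ℤ) ≤ m → m < i + 1 →
      (((m : ℝ), 2 * (i : ℝ)) : Plane) ∈ fourfold (ofCode '' (upperCodes i)) := fun m h h' =>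
    key (4 * m, 2 * i) _ ((mem _).2 (Or.inr (Or.inr (Or.inr (Or.inl ⟨m, ⟨h, h'⟩, rfl⟩)))))
      (by unfold ofCode; push_cast; congr 1; ring)
  rintro q (⟨m, hm1, hm2, hq⟩ | ⟨m, hm1, hm2, hm3, hq⟩)
  · simp only [patternA, Set.mem_insert_iff, Set.mem_singleton_iff] at hq
    rcases hq with rfl | rfl | rfl | rfl | rfl | rfl
    · exact top m (by omega) (by omega)
    · have := top (m + 1) (by omega) (by omega)
      push_cast at this
      exact this
    · refine key (4 * m + 1, 2 * i) _
        ((mem _).2 (Or.inr (Or.inr (Or.inr (Or.inr (Or.inl ⟨m, ⟨hm1, hm2⟩, rfl⟩)))))) ?_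
      unfold ofCode; push_cast; congr 1; ring
    · refine key (4 * m + 3, 2 * i) _
        ((mem _).2 (Or.inr (Or.inr (Or.inr (Or.inr (Or.inr ⟨m, ⟨hm1, hm2⟩, rfl⟩)))))) ?_
      unfold ofCode; push_cast; congr 1; ring
    · exact mid m hm1 (by omega)
    · have := mid (m + 1) (by omega) (by omega)
      push_cast at this
      exact this
  · simp only [patternB, Set.mem_insert_iff, Set.mem_singleton_iff] at hq
    rcases hq with rfl | rfl | rfl
    · exact top m hm1 hm2
    · by_cases h : m < -i
      · refine key (4 * m + 2, 4 * i) _ ((mem _).2 (Or.inr (Or.inl ⟨m, ⟨hm1, h⟩, rfl⟩))) ?_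
        unfold ofCode; push_cast; congr 1; ring
      · refine key (4 * m + 2, 4 * i) _
          ((mem _).2 (Or.inr (Or.inr (Or.inl ⟨m, ⟨by omega, hm2⟩, rfl⟩)))) ?_
        unfold ofCode; push_cast; congr 1; ring
    · by_cases h : m + 1 < 4 * i
      · have := top (m + 1) (by omega) h
        push_cast at this
        exact this
      -- The corner `(4i, 4i)` lies outside the half-open sector; its quarter turn is the corner
      -- `(-4i, 4i)`.
      · have hm : m + 1 = 4 * i := by omega
        have hm' : (m : ℝ) + 1 = 4 * i := by exact_mod_cast hm
        rw [hm', ← rot_mem_fourfold]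
        have := top (-(4 * i)) le_rfl (by omega)
        push_cast at this
        exact this

theorem deepSlope_lt {i : ℕ} (h1 : 1 ≤ i) {d d' : ℤ} (hd : d ≠ 0) (hd' : d' ≠ 0) (h : d < d') :
    deepSlope i d < deepSlope i d' := by
  have h' : (d : ℝ) < d' := by exact_mod_cast h
  rcases lt_or_gt_of_ne hd with n | n
  · have n1 : (d : ℝ) ≤ -1 := by exact_mod_cast (show d ≤ -1 by omega)
    rw [deepSlope_of_neg (by linarith)]
    rcases lt_or_gt_of_ne hd' with n' | n'
    · have n2 : (d' : ℝ) ≤ -1 := by exact_mod_cast (show d' ≤ -1 by omega)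
      rw [deepSlope_of_neg (by linarith)]
      exact neg_lt_neg (axisSlope_strictMono h1 (by linarith) (by linarith))
    · have n2 : (1 : ℝ) ≤ d' := by exact_mod_cast (show 1 ≤ d' by omega)
      rw [deepSlope_of_pos (by linarith)]
      linarith [axisSlope_pos h1 n2, axisSlope_pos h1 (show 1 ≤ -(d : ℝ) by linarith)]
  · have n1 : (1 : ℝ) ≤ d := by exact_mod_cast (show 1 ≤ d by omega)
    rw [deepSlope_of_pos (by linarith), deepSlope_of_pos (by linarith)]
    exact axisSlope_strictMono h1 n1 h'

/-- Only the difference `k - l` matters, and it takes the `4i - 2` nonzero values strictly between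
`-2i` and `2i`. -/
theorem secondUpper_eq {i : ℕ} (h1 : 1 ≤ i) {x : ℝ} (hx : 0 < x) :
    secondUpper i x = (fun d : ℤ => ((deepSlope i d * x, x) : Plane)) ''
      ((Finset.Ioo (-(2 * (i : ℤ))) (2 * i)).erase 0 : Finset ℤ) := by
  ext g
  rw [mem_secondUpper_iff h1 hx]
  simp only [Finset.coe_erase, Finset.coe_Ioo, Set.mem_image, Set.mem_sdiff, Set.mem_Ioo,
    Set.mem_singleton_iff]
  constructor
  · rintro ⟨k, l, hk, hl, hkl, rfl⟩
    exact ⟨k - l, ⟨by omega, by omega⟩, by push_cast; rfl⟩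
  · rintro ⟨d, ⟨hd, hd0⟩, rfl⟩
    by_cases h : 0 < d
    · exact ⟨d - i, -i, by omega, by omega, by omega, by push_cast; congr 3; ring⟩
    · exact ⟨-i, -i - d, by omega, by omega, by omega, by push_cast; congr 3; ring⟩

theorem secondUpper_finite {i : ℕ} (h1 : 1 ≤ i) {x : ℝ} (hx : 0 < x) :
    (secondUpper i x).Finite := by
  rw [secondUpper_eq h1 hx]
  exact (Finset.finite_toSet _).image _

theorem ncard_secondUpper {i : ℕ} (h1 : 1 ≤ i) {x : ℝ} (hx : 0 < x) :
    (secondUpper i x).ncard = 4 * i - 2 := by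
  rw [secondUpper_eq h1 hx, Set.InjOn.ncard_image, Set.ncard_coe_finset, Finset.card_erase_of_mem,
    Int.card_Ioo]
  · omega
  · simp only [Finset.mem_Ioo]; omega
  · intro d hd d' hd' h
    rw [Finset.mem_coe, Finset.mem_erase] at hd hd'
    simp only [Prod.mk.injEq, mul_eq_mul_right_iff, hx.ne', or_false, and_true] at h
    rcases lt_trichotomy d d' with hlt | heq | hlt
    · exact absurd h (deepSlope_lt h1 hd.1 hd'.1 hlt).ne
    · exact heq
    · exact absurd h (deepSlope_lt h1 hd'.1 hd.1 hlt).ne'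

theorem guards_eq_fourfold {i : ℕ} (h1 : 1 ≤ i) (x : ℝ) :
    guards i x = fourfold (ofCode '' (upperCodes i) ∪ secondUpper i x) := by
  unfold guards firstStep
  apply Set.Subset.antisymm
  · apply Set.union_subset
    · refine fourfold_subset ((firstUpper_subset h1).trans (fourfold_subset fun q hq => ?_))
      exact mem_fourfold.2 (Or.inl (Or.inl hq))
    · exact fourfold_subset fun q hq => mem_fourfold.2 (Or.inl (Or.inr hq))
  · intro q hq
    have hsub : ofCode '' (upperCodes i) ∪ secondUpper i x ⊆ firstUpper i ∪ secondUpper i x :=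
      Set.union_subset_union_left _ (ofCode_upperCodes_subset h1)
    simp only [Set.mem_union, mem_fourfold]
    rcases mem_fourfold.1 hq with h | h | h | h <;> rcases hsub h with h | h <;> tauto

/-- The four rotated copies of the sector are disjoint, so the count is `4 * ((20i + 1) + (4i -
2))`. -/
theorem guards_finite_and_ncard {i : ℕ} (h1 : 1 ≤ i) {x : ℝ} (hx : 2000 * (i : ℝ) ^ 4 ≤ x) :
    (guards i x).Finite ∧ (guards i x).ncard = 96 * i - 4 := by
  have hi1 : (1 : ℝ) ≤ i := by exact_mod_cast h1
  have hi4 : (i : ℝ) ≤ i ^ 4 := by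
    calc (i : ℝ) = i ^ 1 := (pow_one _).symm
      _ ≤ i ^ 4 := pow_le_pow_right₀ hi1 (by norm_num)
  have hx0 : 0 < x := by linarith
  have hfin : (ofCode '' (upperCodes i) ∪ secondUpper i x).Finite :=
    ((Finset.finite_toSet _).image _).union (secondUpper_finite h1 hx0)
  rw [guards_eq_fourfold h1]
  refine ⟨fourfold_finite hfin, ?_⟩
  rw [ncard_fourfold hfin, Set.ncard_union_eq _ ((Finset.finite_toSet _).image _)
    (secondUpper_finite h1 hx0), Set.ncard_image_of_injective _ ofCode_injective,
    Set.ncard_coe_finset, card_upperCodes h1, ncard_secondUpper h1 hx0]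
  · omega
  · rw [Set.disjoint_left]
    intro q hq hq'
    obtain ⟨-, h, -⟩ := firstUpper_bounds h1 (ofCode_upperCodes_subset h1 hq)
    obtain ⟨k, l, -, -, -, rfl⟩ := (mem_secondUpper_iff h1 hx0).1 hq'
    simp only at h
    linarith
  · rintro q (⟨c, hc, rfl⟩ | hq)
    · have h0 : 0 < c.2 ∧ -(4 * c.2) ≤ c.1 ∧ c.1 < 4 * c.2 := by
        simp only [upperCodes, Finset.coe_union, Finset.coe_image, Finset.coe_Ico, Set.mem_union,
          Set.mem_image, Set.mem_Ico] at hc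
        rcases hc with ⟨m, hm, rfl⟩ | ⟨m, hm, rfl⟩ | ⟨m, hm, rfl⟩ | ⟨m, hm, rfl⟩ | ⟨m, hm, rfl⟩ |
          ⟨m, hm, rfl⟩ <;> simp only <;> omega
      have e1 : (0 : ℝ) < c.2 := by exact_mod_cast h0.1
      have e2 : -(4 * (c.2 : ℝ)) ≤ c.1 := by exact_mod_cast h0.2.1
      have e3 : (c.1 : ℝ) < 4 * c.2 := by exact_mod_cast h0.2.2
      simp only [sector, ofCode, Set.mem_ofPred_eq]
      exact ⟨e1, by linarith, by linarith⟩
    · obtain ⟨k, l, hk, hl, hkl, rfl⟩ := (mem_secondUpper_iff h1 hx0).1 hq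
      obtain ⟨a, b⟩ := abs_lt.1 (abs_deepSlope_lt_one h1 hk hl hkl)
      simp only [sector, Set.mem_ofPred_eq]
      exact ⟨hx0, by nlinarith, by nlinarith⟩

theorem tendsto_theta : Tendsto theta atTop (𝓝 0) := by
  have h : Tendsto (fun i : ℕ => 1 / (8 * (i : ℝ))) atTop (𝓝 0) := by
    simp only [one_div, mul_inv]
    simpa using (tendsto_inv_atTop_nhds_zero_nat (𝕜 := ℝ)).const_mul (8⁻¹ : ℝ)
  have h2 := ((Real.continuous_arctan.tendsto 0).comp h).const_mul 2
  rw [Real.arctan_zero, mul_zero] at h2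
  exact h2

/-- For `i ≥ 2` one has `(i - 1) ^ 2 ≥ i ^ 2 / 4`, and `96 ^ 2 / 40000 < 1 / 4`; for `i = 1` the
bound 1 suffices, as `92 ^ 2 < 40000`. -/
theorem ofReal_le_complexity {i : ℕ} (h1 : 1 ≤ i) {x : ℝ} (hx : 2000 * (i : ℝ) ^ 4 ≤ x) :
    ENNReal.ofReal (1 / 40000 * ((guards i x).ncard : ℝ) ^ 2) ≤
      ((complexity (thetaRegion (theta i) (guards i x)) : ℕ∞) : ℝ≥0∞) := by
  have hc := le_complexity_thetaRegion h1 hx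
  rw [← ENat.toENNReal_le] at hc
  refine le_trans ?_ hc
  rw [ENat.toENNReal_coe, (guards_finite_and_ncard h1 hx).2, ENNReal.ofReal_le_natCast]
  have hn : ((96 * i - 4 : ℕ) : ℝ) ≤ 96 * i := by
    exact_mod_cast (show 96 * i - 4 ≤ 96 * i by omega)
  have hn2 : ((96 * i - 4 : ℕ) : ℝ) ^ 2 ≤ (96 * i) ^ 2 := by gcongr
  rcases h1.eq_or_lt with rfl | h2
  · norm_num
  · have h2' : (2 : ℝ) ≤ i := by exact_mod_cast h2
    have e : (((i - 1) ^ 2 : ℕ) : ℝ) = ((i : ℝ) - 1) ^ 2 := by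
      push_cast [Nat.cast_sub h1]; ring
    refine le_trans ?_ (Nat.cast_le.2 (le_max_left _ _))
    rw [e]
    nlinarith

end ThetaGuard

theorem mainTheorem4 :
    Tendsto ThetaGuard.theta atTop (𝓝 0) ∧
    ∃ (c : ℝ) (X : ℕ → ℝ), 0 < c ∧ ∀ i : ℕ, 1 ≤ i → ∀ x : ℝ, X i ≤ x →
      -- the input consists of `96 i - 4` guards
      (ThetaGuard.guards i x).Finite ∧
      (ThetaGuard.guards i x).ncard = 96 * i - 4 ∧
      -- all unwanted cones are kept out of the box
      (∀ (p : ThetaGuard.Plane) (φ : ℝ),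
        ThetaGuard.IsEmptyOf (ThetaGuard.cone (ThetaGuard.theta i) p φ)
          (ThetaGuard.guards i x) →
        (ThetaGuard.cone (ThetaGuard.theta i) p φ ∩ ThetaGuard.box i).Nonempty →
        ThetaGuard.IsWantedCone i p φ) ∧
      -- inside the box the region has `(2 i + 1) ^ 2` connected components
      Nat.card (ConnectedComponents
        ↥(ThetaGuard.thetaRegion (ThetaGuard.theta i) (ThetaGuard.guards i x) ∩
          ThetaGuard.box i)) = (2 * i + 1) ^ 2 ∧
      -- the complexity of the region is at least `c n ^ 2`, where `n` is the number of guards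
      ENNReal.ofReal (c * ((ThetaGuard.guards i x).ncard : ℝ) ^ 2) ≤
        ((ThetaGuard.complexity
          (ThetaGuard.thetaRegion (ThetaGuard.theta i) (ThetaGuard.guards i x)) : ℕ∞) : ℝ≥0∞) := by
  refine ⟨ThetaGuard.tendsto_theta, 1 / 40000, fun i => 2000 * (i : ℝ) ^ 4, by norm_num,
    fun i h1 x hx => ?_⟩
  obtain ⟨hfin, hcard⟩ := ThetaGuard.guards_finite_and_ncard h1 hx
  exact ⟨hfin, hcard, fun p φ hemp hne => ThetaGuard.isWantedCone_of_isEmptyOf h1 hx hemp hne,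
    ThetaGuard.card_connectedComponents_thetaRegion h1 hx, ThetaGuard.ofReal_le_complexity h1 hx⟩
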